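/- Let $(a,b,c)$ be a reduced Fricke triple: real numbers with $a^2+b^2+c^2=abc$ and $2<a\le b\le c<ab/2$. Let $S^a$ be the translation $w\mapsto w+a$ of the upper half-plane $\mathcal H$, and let $$T_0=\begin{pmatrix}0&*\\ c/a&0\end{pmatrix},\quad T_1=\begin{pmatrix}a/c&*\\ b/a&-a/c\end{pmatrix},\quad T_2=\begin{pmatrix}a-b/c&*\\ 1&-a+b/c\end{pmatrix}$$ (determinant one). They generate a Fuchsian group $\Gamma$ of signature $(0;2,2,2;\infty)$. For triples of order-two elements put $$\nu(E,F,G)=(FEF,G,S^aFS^{-a}),\quad \rho(E,F,G)=(FGF,F,S^aES^{-a}),\quad \lambda(E,F,G)=(EFE,E,G).$$ Let $\mathcal T^{\nu}_{\lambda,\rho}$ be the tree whose nodes are all triples obtained from $(T_0,T_1,T_2)$ or from $\nu(T_0,T_1,T_2)$ by finite compositions (including the identity) of $\lambda$ and $\rho$. Every entry $T$ of every node is an elliptic element of order two of $\Gamma$; writing $1/z$ for the height of its fixed point, one has $z>2/a$, and its excision width is $w_a(T)=a-\sqrt{a^2-4/z^2}$, which depends only on $T$ modulo conjugation by powers of $S^a$.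 (1) The sum of the widths $w_a(T)$, over all order-two elements $T$ that occur as entries of nodes of $\mathcal T^{\nu}_{\lambda,\rho}$, where elements of $\mathrm{PSL}(2,\mathbb R)$ conjugate to one another by a power of $S^a$ are counted once, converges and is at most $a$. (2) For every such $T$ the element $S^aT$ is hyperbolic, and the closed geodesic $\gamma$ of $\Gamma\backslash\mathcal H$ onto which its axis projects satisfies $$\frac{1}{1+e^{\ell(\gamma)}}=\frac{w_a(T)}{2a},$$ where $\ell(\gamma)$ is the translation length of a primitive hyperbolic element of $\Gamma$ whose axis projects to $\gamma$. Every simple closed geodesic of $\Gamma\backslash\mathcal H$ is of this form. (3) Consequently the upper bound in McShane's identity holds: summing over all simple closed geodesics $\gamma$ of $\Gamma\backslash\mathcal H$ (those any two distinct lifts of which to $\mathcal H$ are disjoint), the series converges and $$\sum_\gamma \frac{1}{1+e^{\ell(\gamma)}}\le\frac12 .$$ -/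

import Mathlib

open scoped Pointwise MatrixGroups
open UpperHalfPlane

noncomputable section

namespace McShane

/-! ### Order-two elements, translations and excision widths -/

/-- The determinant-one matrix with rows `(α, *)` and `(γ, -α)`, where `γ ≠ 0`. -/
def halfTurn (α γ : ℝ) (hγ : γ ≠ 0) : SL(2, ℝ) :=
  ⟨!![α, -(1 + α ^ 2) / γ; γ, -α], by
    rw [Matrix.det_fin_two_of]; field_simp; ring⟩

/-- The translation `w ↦ w + t`. -/
def transl (t : ℝ) : SL(2, ℝ) :=
  ⟨!![1, t; 0, 1], by rw [Matrix.det_fin_two_of]; ring⟩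

/-- The reciprocal of the height of the fixed point of an elliptic element of order two with rows
`(α, β)` and `(γ, -α)`; this fixed point is `α / γ + i / |γ|`. -/
def invHeight (T : SL(2, ℝ)) : ℝ := |T 1 0|

/-- The excision width `a - √(a² - 4 / z²)`, where `1 / z` is the height of the fixed point
of `T`. -/
def exciseWidth (a : ℝ) (T : SL(2, ℝ)) : ℝ := a - √(a ^ 2 - 4 / invHeight T ^ 2)

theorem transl_add (s t : ℝ) : transl (s + t) = transl s * transl t := by
  apply Subtype.ext
  change !![1, s + t; 0, 1] = !![1, s; 0, 1] * !![1, t; 0, 1]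
  simp [add_comm]

theorem transl_zero : transl 0 = 1 := by
  apply Subtype.ext
  change !![1, 0; 0, 1] = (1 : Matrix (Fin 2) (Fin 2) ℝ)
  exact Matrix.one_fin_two.symm

/-- `A` and `B` define Möbius transformations (`±B` being the same transformation) that are
conjugate to one another by a power of the translation `w ↦ w + a`. -/
def TranslConj (a : ℝ) (A B : SL(2, ℝ)) : Prop :=
  ∃ k : ℤ, B = transl (k * a) * A * transl (-(k * a)) ∨
    B = -(transl (k * a) * A * transl (-(k * a)))

theorem translConj_equivalence (a : ℝ) : Equivalence (TranslConj a) where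
  refl A := ⟨0, Or.inl (by simp [transl_zero])⟩
  symm := by
    have key : ∀ (t : ℝ) (A : SL(2, ℝ)),
        transl (-t) * (transl t * A * transl (-t)) * transl (- -t) = A := by
      intro t A
      have h : transl (-t) * transl t = 1 := by rw [← transl_add]; simp [transl_zero]
      calc _ = (transl (-t) * transl t) * A * (transl (-t) * transl t) := by
            simp only [neg_neg, mul_assoc]
        _ = A := by simp [h]
    rintro A B ⟨k, rfl | rfl⟩
    · refine ⟨-k, Or.inl ?_⟩
      have := key (k * a) A
      simpa using this.symm
    · refine ⟨-k, Or.inr ?_⟩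
      have := key (k * a) A
      simpa using this.symm
  trans := by
    have key : ∀ (s t : ℝ) (A : SL(2, ℝ)),
        transl s * (transl t * A * transl (-t)) * transl (-s)
          = transl (s + t) * A * transl (-(s + t)) := by
      intro s t A
      rw [transl_add, show -(s + t) = -t + -s by ring, transl_add]
      simp only [mul_assoc]
    rintro A B C ⟨k, hk⟩ ⟨l, hl⟩
    refine ⟨l + k, ?_⟩
    have h := key (l * a) (k * a) A
    push_cast
    rw [add_mul, ← h]
    rcases hk with rfl | rfl <;> rcases hl with rfl | rfl <;> simp

/-- Transformations modulo conjugation by powers of the translation `w ↦ w + a`. -/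
def translSetoid (a : ℝ) : Setoid SL(2, ℝ) := ⟨TranslConj a, translConj_equivalence a⟩

theorem invHeight_eq_of_translConj {a : ℝ} {A B : SL(2, ℝ)} (h : TranslConj a A B) :
    invHeight A = invHeight B := by
  have key : ∀ t : ℝ, (transl t * A * transl (-t)) 1 0 = A 1 0 := by
    intro t
    change (!![1, t; 0, 1] * A.1 * !![1, -t; 0, 1]) 1 0 = A.1 1 0
    simp [Matrix.mul_apply, Fin.sum_univ_two, Matrix.vecMul, dotProduct]
  obtain ⟨k, rfl | rfl⟩ := h
  · simp only [invHeight, key]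
  · simp only [invHeight, Matrix.SpecialLinearGroup.coe_neg, Matrix.neg_apply, abs_neg, key]

/-- The excision width, as a function of the class of `T` modulo conjugation by powers of the
translation `w ↦ w + a`. -/
def classWidth (a : ℝ) : Quotient (translSetoid a) → ℝ :=
  Quotient.lift (exciseWidth a) fun _ _ h => by
    simp only [exciseWidth, invHeight_eq_of_translConj h]

/-! ### Simple closed geodesics of a quotient of the upper half-plane -/

/-- The axis of the hyperbolic transformation `w ↦ (p w + q) / (r w + s)`: the hyperbolic line
joining the two solutions of `r x² + (s - p) x - q = 0`, i.e. its two fixed points. -/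
def axis (M : SL(2, ℝ)) : Set ℍ :=
  {w | M 1 0 * (w.re ^ 2 + w.im ^ 2) + (M 1 1 - M 0 0) * w.re - M 0 1 = 0}

/-- The translation length `2 log ε` of a hyperbolic transformation, `ε` being the larger solution
of `ε + 1 / ε = t` with `t` the absolute value of the trace. -/
def translationLength (M : SL(2, ℝ)) : ℝ :=
  2 * Real.log ((|M.1.trace| + √(M.1.trace ^ 2 - 4)) / 2)

/-- A geodesic of `Γ \ ℍ` is given by the `Γ`-orbit of hyperbolic lines formed by its lifts. This
is the geodesic onto which the axis of `M` projects. -/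
def projAxis (Γ : Subgroup SL(2, ℝ)) (M : SL(2, ℝ)) : Set (Set ℍ) :=
  MulAction.orbit Γ (axis M)

/-- The simple closed geodesics of `Γ \ ℍ`: the projections of axes of hyperbolic elements of `Γ`
any two distinct lifts of which are disjoint. -/
def simpleClosedGeodesics (Γ : Subgroup SL(2, ℝ)) : Set (Set (Set ℍ)) :=
  {γ | (∃ M ∈ Γ, M.1.IsHyperbolic ∧ γ = projAxis Γ M) ∧ γ.PairwiseDisjoint id}

/-- The length of a closed geodesic of `Γ \ ℍ`, `Γ` discrete: the least translation length (that of
a primitive element) of the hyperbolic elements of `Γ` whose axis projects to it. -/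
def geodesicLength (Γ : Subgroup SL(2, ℝ)) (γ : Set (Set ℍ)) : ℝ :=
  sInf {l | ∃ M ∈ Γ, M.1.IsHyperbolic ∧ axis M ∈ γ ∧ l = translationLength M}

/-! ### Fricke triples, their groups and their trees -/

/-- A (reduced) Fricke triple. -/
structure FrickeTriple where
  a : ℝ
  b : ℝ
  c : ℝ
  two_lt : 2 < a
  a_le_b : a ≤ b
  b_le_c : b ≤ c
  c_lt : c < a * b / 2
  fricke : a ^ 2 + b ^ 2 + c ^ 2 = a * b * c

namespace FrickeTriple

variable (τ : FrickeTriple)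

theorem a_pos : 0 < τ.a := by linarith [τ.two_lt]

theorem b_pos : 0 < τ.b := τ.a_pos.trans_le τ.a_le_b

theorem c_pos : 0 < τ.c := τ.b_pos.trans_le τ.b_le_c

/-- The fundamental translation `w ↦ w + a`. -/
def S : SL(2, ℝ) := transl τ.a

def T₀ : SL(2, ℝ) := halfTurn 0 (τ.c / τ.a) (div_pos τ.c_pos τ.a_pos).ne'

def T₁ : SL(2, ℝ) := halfTurn (τ.a / τ.c) (τ.b / τ.a) (div_pos τ.b_pos τ.a_pos).ne'

def T₂ : SL(2, ℝ) := halfTurn (τ.a - τ.b / τ.c) 1 one_ne_zero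

/-- The Fuchsian group of signature `(0; 2, 2, 2; ∞)` of the Fricke triple. -/
def group : Subgroup SL(2, ℝ) := Subgroup.closure {τ.T₀, τ.T₁, τ.T₂}

/-- Triples `(E, F, G)`. -/
abbrev Triple : Type := SL(2, ℝ) × SL(2, ℝ) × SL(2, ℝ)

def moveNu : Triple → Triple
  | (E, F, G) => (F * E * F, G, τ.S * F * τ.S⁻¹)

def moveRho : Triple → Triple
  | (E, F, G) => (F * G * F, F, τ.S * E * τ.S⁻¹)

def moveLambda : Triple → Triple
  | (E, F, G) => (E * F * E, E, G)

/-- The triples obtained from `t` by finite compositions of the moves `λ` and `ρ`. -/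
inductive SubtreeNode (t : Triple) : Triple → Prop
  | root : SubtreeNode t t
  | lam {s : Triple} : SubtreeNode t s → SubtreeNode t (moveLambda s)
  | rho {s : Triple} : SubtreeNode t s → SubtreeNode t (τ.moveRho s)

/-- The nodes of the full tree: those of the `λ`, `ρ`-trees that start at `(T₀, T₁, T₂)` and at
`ν(T₀, T₁, T₂)`. -/
def IsNode (s : Triple) : Prop :=
  τ.SubtreeNode (τ.T₀, τ.T₁, τ.T₂) s ∨ τ.SubtreeNode (τ.moveNu (τ.T₀, τ.T₁, τ.T₂)) s

/-- `T` is an entry of the triple at some node of the tree. -/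
def Occurs (T : SL(2, ℝ)) : Prop :=
  ∃ E F G : SL(2, ℝ), τ.IsNode (E, F, G) ∧ (T = E ∨ T = F ∨ T = G)

/-- The entries of the triples at the nodes of the tree, as transformations modulo conjugation by
powers of `S`. -/
def occurringClasses : Set (Quotient (translSetoid τ.a)) :=
  {q | ∃ T, τ.Occurs T ∧ q = Quotient.mk (translSetoid τ.a) T}

end FrickeTriple

end McShane

end

noncomputable section

namespace McShane

/-! ### Half-turns -/

/-! A triple of the tree consists, up to sign, of half-turns `P`, `Q`, `R` about `u + i/x`, `v +
i/y`, `w + i/z` with `x² + y² + z² = axyz` and `R Q P` equal to the translation by `a`; such data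
form a `Chart`. The moves of the tree are one Vieta flip `Chart.lam` combined with the cyclic shift
`(P, Q, R) ↦ (Q, R, S P S⁻¹)`. Hence, up to shifts and translations, the nodes are closed under
every flip (`Reach.lam`), and all charts reached generate the same group. Widths. The three gaps
between consecutive fixed points add up to `a`. From them one builds a `mass` for each chart that is
nonnegative and equals the width at the chart plus the masses of its two children (`mass_nonneg`,
`mass_eq`). Hence partial sums over a subtree are at most the mass of its root, and the widths of
the root triple plus the masses of the three branches add up to exactly `a`. Lengths. The half-turns
fix points on the three sides of the ideal triangle `∞, u, w`. Ping-pong, written with quadratic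
forms (`form_val_nonneg`), shows that nontrivial elements move the interior of the triangle off
itself. So no half-turn of the group fixes a point strictly between the fixed points of `P` and `R`,
and `P R` has least trace on its axis (`sq_trace_le`). Up to sign `S T` is the inverse of such a
product, with trace `±az`, which turns its length into a width. Simple geodesics. A hyperbolic
element is a word in `P`, `Q`, `R`; reduce it cyclically. If some pair of letters is never
cyclically adjacent, the word is a power of a product of two half-turns or becomes shorter in a
neighbouring chart (`exists_shorter`). If all pairs are adjacent, lifts of the geodesic cut off
every corner of the triangle; nesting these lifts at the cusp gives a half-circle wider than `a`,
which crosses its own translate (`false_of_fan`). By induction on length every simple geodesic comes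
from the tree. Summing widths over the resulting injection into classes gives `a / (2a) = 1/2`;
simplicity of all geodesics of the tree is not needed for the upper bound. -/

theorem sl_ext {A B : SL(2, ℝ)} (h00 : A 0 0 = B 0 0) (h01 : A 0 1 = B 0 1)
    (h10 : A 1 0 = B 1 0) (h11 : A 1 1 = B 1 1) : A = B := by
  ext i j
  fin_cases i <;> fin_cases j <;> assumption

theorem sl_mul_apply (A B : SL(2, ℝ)) (i j : Fin 2) :
    (A * B) i j = A i 0 * B 0 j + A i 1 * B 1 j := by
  change (A.1 * B.1) i j = _
  rw [Matrix.mul_apply, Fin.sum_univ_two]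

theorem sl_neg_apply (A : SL(2, ℝ)) (i j : Fin 2) : (-A) i j = -A i j := rfl

theorem sl_one_apply : (1 : SL(2, ℝ)) 0 0 = 1 ∧ (1 : SL(2, ℝ)) 0 1 = 0 ∧
    (1 : SL(2, ℝ)) 1 0 = 0 ∧ (1 : SL(2, ℝ)) 1 1 = 1 := by
  refine ⟨?_, ?_, ?_, ?_⟩ <;> simp

theorem sl_det (A : SL(2, ℝ)) : A 0 0 * A 1 1 - A 0 1 * A 1 0 = 1 := by
  have := A.2
  rwa [Matrix.det_fin_two] at this

theorem sl_inv_apply (A : SL(2, ℝ)) : A⁻¹ 0 0 = A 1 1 ∧ A⁻¹ 0 1 = -A 0 1 ∧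
    A⁻¹ 1 0 = -A 1 0 ∧ A⁻¹ 1 1 = A 0 0 := by
  refine ⟨?_, ?_, ?_, ?_⟩ <;> simp [Matrix.SpecialLinearGroup.coe_inv, Matrix.adjugate_fin_two]

theorem transl_apply (t : ℝ) : transl t 0 0 = 1 ∧ transl t 0 1 = t ∧
    transl t 1 0 = 0 ∧ transl t 1 1 = 1 := ⟨rfl, rfl, rfl, rfl⟩

theorem transl_neg (t : ℝ) : transl (-t) = (transl t)⁻¹ := by
  rw [eq_inv_iff_mul_eq_one, ← transl_add, neg_add_cancel, transl_zero]

/-- The half-turn of the upper half-plane about `u + i / z`. -/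
def turn (u z : ℝ) (hz : 0 < z) : SL(2, ℝ) := halfTurn (u * z) z hz.ne'

theorem turn_apply (u z : ℝ) (hz : 0 < z) : turn u z hz 0 0 = u * z ∧
    turn u z hz 0 1 = -(1 + (u * z) ^ 2) / z ∧ turn u z hz 1 0 = z ∧
    turn u z hz 1 1 = -(u * z) := ⟨rfl, rfl, rfl, rfl⟩

theorem turn_congr {u v z w : ℝ} (hz : 0 < z) (hw : 0 < w) (h : u = v) (h' : z = w) :
    turn u z hz = turn v w hw := by
  subst h; subst h'; rfl

theorem halfTurn_eq_turn {α γ u z : ℝ} (hγ : γ ≠ 0) (hz : 0 < z) (h : α = u * z) (h' : γ = z) :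
    halfTurn α γ hγ = turn u z hz := by
  subst h; subst h'; rfl

theorem turn_mul_self (u z : ℝ) (hz : 0 < z) : turn u z hz * turn u z hz = -1 := by
  obtain ⟨h1, h2, h3, h4⟩ := turn_apply u z hz
  obtain ⟨o1, o2, o3, o4⟩ := sl_one_apply
  apply sl_ext <;> simp only [sl_mul_apply, sl_neg_apply, h1, h2, h3, h4, o1, o2, o3, o4] <;>
    field_simp <;> ring

theorem transl_conj_turn (t u z : ℝ) (hz : 0 < z) :
    transl t * turn u z hz * (transl t)⁻¹ = turn (u + t) z hz := by
  rw [mul_inv_eq_iff_eq_mul]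
  obtain ⟨h1, h2, h3, h4⟩ := turn_apply u z hz
  obtain ⟨k1, k2, k3, k4⟩ := turn_apply (u + t) z hz
  obtain ⟨o1, o2, o3, o4⟩ := transl_apply t
  apply sl_ext <;> simp only [sl_mul_apply, h1, h2, h3, h4, k1, k2, k3, k4, o1, o2, o3, o4] <;>
    field_simp <;> ring

/-- The half-turn about `u + i/x` is `s ↦ u - 1 / (x² (s - u))`; it takes `u + d + i/w` to `u - d w
/ z + i/z`. -/
theorem turn_conj_turn {u x d w u' z : ℝ} (hx : 0 < x) (hw : 0 < w) (hz : 0 < z)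
    (hzeq : z = x ^ 2 * (d ^ 2 * w + 1 / w)) (hu : u' = u - d * w / z) :
    turn u x hx * turn (u + d) w hw * (turn u x hx)⁻¹ = turn u' z hz := by
  rw [mul_inv_eq_iff_eq_mul]
  obtain ⟨h1, h2, h3, h4⟩ := turn_apply u x hx
  obtain ⟨k1, k2, k3, k4⟩ := turn_apply (u + d) w hw
  obtain ⟨o1, o2, o3, o4⟩ := turn_apply u' z hz
  have hu2 : u' * z = u * z - d * w := by rw [hu]; field_simp
  have hq : z = x ^ 2 * (d ^ 2 * w ^ 2 + 1) / w := by rw [hzeq]; field_simp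
  have hd : d ^ 2 * w ^ 2 + 1 ≠ 0 := by positivity
  apply sl_ext <;>
    simp only [sl_mul_apply, h1, h2, h3, h4, k1, k2, k3, k4, o1, o2, o3, o4, hu2] <;>
    rw [hq] <;> field_simp <;> ring

/-! ### Charts -/

/-- Triples of half-turns about `u + i / x`, `v + i / y`, `w + i / z`, where
`v - u = z / (x y)`, `w - v = x / (y z)` and `u + a - w = y / (x z)`. -/
@[ext] structure Chart (a : ℝ) where
  u : ℝ
  x : ℝ
  y : ℝ
  z : ℝ
  hx : 0 < x
  hy : 0 < y
  hz : 0 < z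
  markoff : x ^ 2 + y ^ 2 + z ^ 2 = a * x * y * z

namespace Chart

variable {a : ℝ} (c : Chart a)

def v : ℝ := c.u + c.z / (c.x * c.y)

def w : ℝ := c.v + c.x / (c.y * c.z)

def P : SL(2, ℝ) := turn c.u c.x c.hx

def Q : SL(2, ℝ) := turn c.v c.y c.hy

def R : SL(2, ℝ) := turn c.w c.z c.hz

/-- The cyclic shift `(P, Q, R) ↦ (Q, R, S P S⁻¹)`. -/
def shift : Chart a :=
  ⟨c.v, c.y, c.z, c.x, c.hy, c.hz, c.hx, by linarith [c.markoff]⟩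

/-- The flip `(P, Q, R) ↦ (P Q P⁻¹, P, R)`. -/
def lam : Chart a where
  u := c.u - c.z / (c.x * ((c.x ^ 2 + c.z ^ 2) / c.y))
  x := (c.x ^ 2 + c.z ^ 2) / c.y
  y := c.x
  z := c.z
  hx := by have := c.hx; have := c.hy; positivity
  hy := c.hx
  hz := c.hz
  markoff := by
    have h := c.markoff
    have := c.hy
    field_simp
    linear_combination (c.x ^ 2 + c.z ^ 2) * h

/-- Translation by `t`. -/
def trans (t : ℝ) : Chart a :=
  ⟨c.u + t, c.x, c.y, c.z, c.hx, c.hy, c.hz, c.markoff⟩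

/-- The Markoff equation says that the gaps `z/(xy)`, `x/(yz)`, `y/(xz)` add up to `a`. -/
theorem shift_shift_shift : c.shift.shift.shift = c.trans a := by
  have := c.hx; have := c.hy; have := c.hz
  have h := c.markoff
  ext <;> simp only [shift, trans, v]
  field_simp
  linear_combination h

/-- The flip replaces `y` by the other root of the Markoff equation in `y`, so flipping the same
position twice leads back. This is why `ν` undoes `λ` up to a shift. -/
theorem lam_shift_shift_lam : c.lam.shift.shift.lam = c.shift := by
  have := c.hx; have := c.hy; have := c.hz
  ext <;> simp only [shift, lam, v] <;> field_simp <;> ring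

theorem trans_trans (s t : ℝ) : (c.trans s).trans t = c.trans (s + t) := by
  ext <;> simp only [trans]; ring

theorem trans_zero : c.trans 0 = c := by
  ext <;> simp only [trans]; ring

theorem trans_shift (t : ℝ) : (c.trans t).shift = c.shift.trans t := by
  ext <;> simp only [trans, shift, v]; ring

theorem trans_lam (t : ℝ) : (c.trans t).lam = c.lam.trans t := by
  ext <;> simp only [trans, lam]; ring

theorem trans_P (t : ℝ) : (c.trans t).P = transl t * c.P * (transl t)⁻¹ := by
  rw [P, P, transl_conj_turn]; rfl

theorem trans_Q (t : ℝ) : (c.trans t).Q = transl t * c.Q * (transl t)⁻¹ := by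
  rw [Q, Q, transl_conj_turn]
  apply turn_congr _ _ _ rfl
  simp only [trans, v]; ring

theorem trans_R (t : ℝ) : (c.trans t).R = transl t * c.R * (transl t)⁻¹ := by
  rw [R, R, transl_conj_turn]
  apply turn_congr _ _ _ rfl
  simp only [trans, w, v]; ring

theorem shift_P : c.shift.P = c.Q := rfl

theorem shift_Q : c.shift.Q = c.R := rfl

theorem w_shift : c.shift.w = c.u + a := by
  have := congrArg Chart.u c.shift_shift_shift
  exact this

theorem shift_R : c.shift.R = transl a * c.P * (transl a)⁻¹ := by
  rw [R, P, transl_conj_turn]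
  exact turn_congr _ _ c.w_shift rfl

theorem lam_P : c.lam.P = c.P * c.Q * c.P⁻¹ := by
  have := c.hx; have := c.hy; have := c.hz
  symm
  apply turn_conj_turn
  · simp only [lam]; field_simp; ring
  · simp only [lam]; field_simp

theorem lam_v : c.lam.v = c.u := by
  have := c.hx; have := c.hy; have := c.hz
  simp only [lam, v]; field_simp; ring

theorem lam_w : c.lam.w = c.w := by
  rw [w, lam_v]
  have := c.hx; have := c.hy; have := c.hz
  simp only [lam, v, w]; field_simp; ring

theorem lam_Q : c.lam.Q = c.P := turn_congr _ _ c.lam_v rfl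

theorem lam_R : c.lam.R = c.R := turn_congr _ _ c.lam_w rfl

theorem P_mul_self : c.P * c.P = -1 := turn_mul_self _ _ _

theorem Q_mul_self : c.Q * c.Q = -1 := turn_mul_self _ _ _

theorem R_mul_self : c.R * c.R = -1 := turn_mul_self _ _ _

theorem transl_eq : transl a = c.R * c.Q * c.P := by
  have := c.hx; have := c.hy; have := c.hz
  have ha : a = (c.x ^ 2 + c.y ^ 2 + c.z ^ 2) / (c.x * c.y * c.z) := by
    rw [eq_div_iff (by positivity)]; linarith [c.markoff]
  obtain ⟨h1, h2, h3, h4⟩ := turn_apply c.u c.x c.hx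
  obtain ⟨k1, k2, k3, k4⟩ := turn_apply c.v c.y c.hy
  obtain ⟨o1, o2, o3, o4⟩ := turn_apply c.w c.z c.hz
  obtain ⟨l1, l2, l3, l4⟩ := transl_apply a
  rw [P, Q, R]
  apply sl_ext <;>
    simp only [sl_mul_apply, h1, h2, h3, h4, k1, k2, k3, k4, o1, o2, o3, o4, l1, l2, l3, l4] <;>
    simp only [ha, w, v] <;> field_simp <;> ring

end Chart

/-! ### Equality up to sign -/

/-- `A` and `B` define the same Möbius transformation. -/
def SignEq (A B : SL(2, ℝ)) : Prop := B = A ∨ B = -A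

theorem SignEq.refl (A : SL(2, ℝ)) : SignEq A A := Or.inl rfl

theorem SignEq.of_eq {A B : SL(2, ℝ)} (h : A = B) : SignEq A B := Or.inl h.symm

theorem SignEq.neg (A : SL(2, ℝ)) : SignEq A (-A) := Or.inr rfl

theorem SignEq.symm {A B : SL(2, ℝ)} (h : SignEq A B) : SignEq B A := by
  rcases h with rfl | rfl
  · exact Or.inl rfl
  · exact Or.inr (by simp)

theorem SignEq.trans {A B C : SL(2, ℝ)} (h : SignEq A B) (h' : SignEq B C) : SignEq A C := by
  rcases h with rfl | rfl <;> rcases h' with rfl | rfl <;> simp [SignEq]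

theorem SignEq.mul {A B C D : SL(2, ℝ)} (h : SignEq A B) (h' : SignEq C D) :
    SignEq (A * C) (B * D) := by
  rcases h with rfl | rfl <;> rcases h' with rfl | rfl <;> simp [SignEq]

theorem SignEq.inv {A B : SL(2, ℝ)} (h : SignEq A B) : SignEq A⁻¹ B⁻¹ := by
  rcases h with rfl | rfl
  · exact Or.inl rfl
  · refine Or.inr ?_
    rw [inv_eq_iff_mul_eq_one]; simp

theorem signEq_inv_of_mul_self {A : SL(2, ℝ)} (h : A * A = -1) : SignEq A A⁻¹ := by
  refine Or.inr ?_
  rw [inv_eq_iff_mul_eq_one, mul_neg, h, neg_neg]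

theorem SignEq.abs_apply {A B : SL(2, ℝ)} (h : SignEq A B) (i j : Fin 2) :
    |A i j| = |B i j| := by
  rcases h with rfl | rfl
  · rfl
  · rw [sl_neg_apply, abs_neg]

theorem SignEq.mul_self {A B : SL(2, ℝ)} (h : SignEq A B) : A * A = B * B := by
  rcases h with rfl | rfl <;> simp

theorem SignEq.translConj {A B : SL(2, ℝ)} (h : SignEq A B) (a : ℝ) : TranslConj a A B := by
  refine ⟨0, ?_⟩
  simpa [transl_zero, SignEq] using h

theorem transl_int_mul (a : ℝ) (k : ℤ) : transl (k * a) = transl a ^ k := by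
  have hn : ∀ n : ℕ, transl (n * a) = transl a ^ n := by
    intro n
    induction n with
    | zero => simp [transl_zero]
    | succ n ih => rw [pow_succ, ← ih, ← transl_add]; push_cast; ring_nf
  obtain ⟨n, rfl | rfl⟩ := k.eq_nat_or_neg
  · simpa using hn n
  · rw [zpow_neg, zpow_natCast, ← hn n, ← transl_neg]; push_cast; ring_nf

theorem translConj_conj (a : ℝ) (A : SL(2, ℝ)) (k : ℤ) :
    TranslConj a A (transl (k * a) * A * (transl (k * a))⁻¹) :=
  ⟨k, Or.inl (by rw [transl_neg])⟩

namespace Chart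

variable {a : ℝ} (c : Chart a)

/-! ### The group of a chart -/

/-- The group generated by the half-turns of a chart. -/
def group : Subgroup SL(2, ℝ) := Subgroup.closure {c.P, c.Q, c.R}

theorem P_mem : c.P ∈ c.group := Subgroup.subset_closure (by simp)

theorem Q_mem : c.Q ∈ c.group := Subgroup.subset_closure (by simp)

theorem R_mem : c.R ∈ c.group := Subgroup.subset_closure (by simp)

theorem neg_one_mem : -1 ∈ c.group := by
  rw [← c.P_mul_self]; exact mul_mem c.P_mem c.P_mem

theorem transl_mem : transl a ∈ c.group := by
  rw [c.transl_eq]; exact mul_mem (mul_mem c.R_mem c.Q_mem) c.P_mem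

theorem transl_int_mem (k : ℤ) : transl (k * a) ∈ c.group := by
  rw [transl_int_mul]; exact zpow_mem c.transl_mem k

theorem group_le {G : Subgroup SL(2, ℝ)} (hP : c.P ∈ G) (hQ : c.Q ∈ G) (hR : c.R ∈ G) :
    c.group ≤ G := by
  rw [group, Subgroup.closure_le]
  rintro x (rfl | rfl | rfl) <;> assumption

theorem shift_group : c.shift.group = c.group := by
  apply le_antisymm
  · apply group_le
    · exact c.Q_mem
    · exact c.R_mem
    · rw [shift_R]
      exact mul_mem (mul_mem c.transl_mem c.P_mem) (inv_mem c.transl_mem)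
  · apply group_le
    · have h := c.shift.R_mem
      rw [shift_R] at h
      have := mul_mem (mul_mem (inv_mem c.shift.transl_mem) h) c.shift.transl_mem
      simpa [mul_assoc] using this
    · exact c.shift.P_mem
    · exact c.shift.Q_mem

theorem lam_group : c.lam.group = c.group := by
  apply le_antisymm
  · apply group_le
    · rw [lam_P]
      exact mul_mem (mul_mem c.P_mem c.Q_mem) (inv_mem c.P_mem)
    · rw [lam_Q]; exact c.P_mem
    · rw [lam_R]; exact c.R_mem
  · have hP : c.P ∈ c.lam.group := by rw [← lam_Q]; exact c.lam.Q_mem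
    apply group_le _ hP
    · have h := c.lam.P_mem
      rw [lam_P] at h
      have := mul_mem (mul_mem (inv_mem hP) h) hP
      simpa [mul_assoc] using this
    · rw [← lam_R]; exact c.lam.R_mem

theorem trans_group_le (k : ℤ) : (c.trans (k * a)).group ≤ c.group := by
  have h := c.transl_int_mem k
  apply group_le
  · rw [trans_P]; exact mul_mem (mul_mem h c.P_mem) (inv_mem h)
  · rw [trans_Q]; exact mul_mem (mul_mem h c.Q_mem) (inv_mem h)
  · rw [trans_R]; exact mul_mem (mul_mem h c.R_mem) (inv_mem h)

theorem trans_group (k : ℤ) : (c.trans (k * a)).group = c.group := by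
  refine le_antisymm (c.trans_group_le k) ?_
  have := (c.trans (k * a)).trans_group_le (-k)
  rwa [trans_trans, show (k : ℝ) * a + ((-k : ℤ) : ℝ) * a = 0 by push_cast; ring,
    trans_zero] at this

/-! ### The tree of charts -/

/-- The charts obtained from `r` by the moves `λ` and `ρ`. -/
inductive Sub (r : Chart a) : Chart a → Prop
  | root : Sub r r
  | lam {c : Chart a} : Sub r c → Sub r c.lam
  | rho {c : Chart a} : Sub r c → Sub r c.shift.lam

/-- The nodes of the full tree with root `r`. -/
def Node (r c : Chart a) : Prop := Sub r c ∨ Sub r.shift.shift.lam c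

/-- The charts that agree with a node of the tree up to a cyclic shift and a translation. -/
def Reach (r c : Chart a) : Prop :=
  ∃ n, Node r n ∧ ∃ k : ℤ,
    c = n.trans (k * a) ∨ c = n.shift.trans (k * a) ∨ c = n.shift.shift.trans (k * a)

variable {c} {r : Chart a}

theorem Node.lam (h : Node r c) : Node r c.lam := h.imp Sub.lam Sub.lam

theorem Node.rho (h : Node r c) : Node r c.shift.lam := h.imp Sub.rho Sub.rho

theorem Node.reach (h : Node r c) : Reach r c :=
  ⟨c, h, 0, Or.inl (by simp [trans_zero])⟩

theorem reach_root : Reach r r := Node.reach (Or.inl Sub.root)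

theorem Reach.shift (h : Reach r c) : Reach r c.shift := by
  obtain ⟨n, hn, k, rfl | rfl | rfl⟩ := h
  · exact ⟨n, hn, k, Or.inr (Or.inl (trans_shift _ _))⟩
  · exact ⟨n, hn, k, Or.inr (Or.inr (trans_shift _ _))⟩
  · refine ⟨n, hn, k + 1, Or.inl ?_⟩
    rw [trans_shift, shift_shift_shift, trans_trans]
    push_cast; ring_nf

theorem Reach.trans (h : Reach r c) (k : ℤ) : Reach r (c.trans (k * a)) := by
  obtain ⟨n, hn, l, rfl | rfl | rfl⟩ := h
  all_goals rw [trans_trans, ← add_mul, ← Int.cast_add]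
  · exact ⟨n, hn, l + k, Or.inl rfl⟩
  · exact ⟨n, hn, l + k, Or.inr (Or.inl rfl)⟩
  · exact ⟨n, hn, l + k, Or.inr (Or.inr rfl)⟩

/-- At a node other than the two roots, `ν` backtracks to the parent; at a root it crosses the edge
that joins the two subtrees. -/
theorem Node.reach_nu (h : Node r c) : Reach r c.shift.shift.lam := by
  rcases h with h | h
  · cases h with
    | root => exact Node.reach (Or.inr Sub.root)
    | lam h => rw [lam_shift_shift_lam]; exact (Node.reach (Or.inl h)).shift
    | rho h => rw [lam_shift_shift_lam]; exact (Node.reach (Or.inl h)).shift.shift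
  · cases h with
    | root => rw [lam_shift_shift_lam]; exact reach_root.shift.shift.shift
    | lam h => rw [lam_shift_shift_lam]; exact (Node.reach (Or.inr h)).shift
    | rho h => rw [lam_shift_shift_lam]; exact (Node.reach (Or.inr h)).shift.shift

theorem Reach.lam (h : Reach r c) : Reach r c.lam := by
  obtain ⟨n, hn, k, rfl | rfl | rfl⟩ := h
  all_goals rw [trans_lam]; apply Reach.trans
  · exact hn.lam.reach
  · exact hn.rho.reach
  · exact hn.reach_nu

theorem Reach.group_eq (h : Reach r c) : c.group = r.group := by
  have hs : ∀ {r n : Chart a}, Sub r n → n.group = r.group := by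
    intro r n h
    induction h with
    | root => rfl
    | lam _ ih => rw [lam_group, ih]
    | rho _ ih => rw [lam_group, shift_group, ih]
  have hn : ∀ {n : Chart a}, Node r n → n.group = r.group := by
    rintro n (h | h)
    · exact hs h
    · rw [hs h, lam_group, shift_group, shift_group]
  obtain ⟨n, h, k, rfl | rfl | rfl⟩ := h <;> simp only [trans_group, shift_group, hn h]

/-! ### Moving one half-turn across another -/

/-- The braid move `(P, Q, R) ↦ (Q, Q P Q⁻¹, R)`. -/
def braidLeft (c : Chart a) : Chart a := c.shift.shift.lam.shift.shift.trans (-a)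

/-- The braid move `(P, Q, R) ↦ (P, R, R Q R⁻¹)`. -/
def braidRight (c : Chart a) : Chart a := c.lam.shift

theorem Reach.braidLeft (h : Reach r c) : Reach r c.braidLeft := by
  have := h.shift.shift.lam.shift.shift.trans (-1)
  simpa [Chart.braidLeft] using this

theorem Reach.braidRight (h : Reach r c) : Reach r c.braidRight := h.lam.shift

variable (c)

theorem braidLeft_P : c.braidLeft.P = c.Q := by
  rw [braidLeft, trans_P, shift_P, shift_Q, lam_R, shift_R, shift_P, transl_neg]
  group

theorem braidLeft_R : c.braidLeft.R = c.R := by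
  rw [braidLeft, trans_R, shift_R, shift_P, lam_Q, shift_P, shift_Q, transl_neg]
  group

theorem braidLeft_Q : SignEq (c.Q * c.P * c.Q) c.braidLeft.Q := by
  have h : c.braidLeft.Q = (c.R * c.R) * (c.Q * c.P * c.Q⁻¹) * (c.R * c.R)⁻¹ := by
    rw [braidLeft, trans_Q, shift_Q, shift_R, lam_P, shift_P, shift_Q, shift_Q, shift_R,
      transl_neg, c.transl_eq]
    group
  rw [h, c.R_mul_self]
  have := signEq_inv_of_mul_self c.Q_mul_self
  simpa using (SignEq.refl (c.Q * c.P)).mul this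

theorem braidRight_P : c.braidRight.P = c.P := by
  rw [braidRight, shift_P, lam_Q]

theorem braidRight_Q : c.braidRight.Q = c.R := by
  rw [braidRight, shift_Q, lam_R]

theorem braidRight_R : SignEq (c.R * c.Q * c.R) c.braidRight.R := by
  have h : c.braidRight.R = c.R * c.Q * (c.P * c.P) * c.Q * (c.P * c.P)⁻¹ * c.Q⁻¹ * c.R⁻¹ := by
    rw [braidRight, shift_R, lam_P, c.transl_eq]
    group
  have h' : c.braidRight.R = c.R * c.Q * c.R⁻¹ := by
    rw [h, c.P_mul_self]
    simp
  rw [h']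
  have := signEq_inv_of_mul_self c.R_mul_self
  exact (SignEq.refl (c.R * c.Q)).mul this

end Chart

/-! ### The tree of a Fricke triple -/

namespace FrickeTriple

variable (τ : FrickeTriple)

/-- The chart `(T₀, T₁, T₂)`. -/
def root : Chart τ.a where
  u := 0
  x := τ.c / τ.a
  y := τ.b / τ.a
  z := 1
  hx := div_pos τ.c_pos τ.a_pos
  hy := div_pos τ.b_pos τ.a_pos
  hz := one_pos
  markoff := by
    have := τ.a_pos
    have := τ.fricke
    field_simp
    linarith

theorem root_P : τ.root.P = τ.T₀ :=
  (halfTurn_eq_turn _ _ (by simp [root]) rfl).symm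

theorem root_Q : τ.root.Q = τ.T₁ := by
  have := τ.a_pos; have := τ.b_pos; have := τ.c_pos
  refine (halfTurn_eq_turn _ _ ?_ rfl).symm
  simp only [Chart.v, root]; field_simp; ring

theorem root_R : τ.root.R = τ.T₂ := by
  have := τ.a_pos; have := τ.b_pos; have := τ.c_pos
  have h := τ.fricke
  refine (halfTurn_eq_turn _ _ ?_ rfl).symm
  simp only [Chart.w, Chart.v, root]; field_simp
  linear_combination -h

theorem root_group : τ.root.group = τ.group := by
  rw [Chart.group, root_P, root_Q, root_R]; rfl

variable {τ}

/-- The triple `s` consists of the half-turns of the chart `c` up to sign. -/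
def Represents (c : Chart τ.a) (s : Triple) : Prop :=
  SignEq s.1 c.P ∧ SignEq s.2.1 c.Q ∧ SignEq s.2.2 c.R

theorem represents_root : Represents τ.root (τ.T₀, τ.T₁, τ.T₂) :=
  ⟨.of_eq τ.root_P.symm, .of_eq τ.root_Q.symm, .of_eq τ.root_R.symm⟩

theorem Represents.lam {c : Chart τ.a} {s : Triple} (h : Represents c s) :
    Represents c.lam (moveLambda s) := by
  obtain ⟨E, F, G⟩ := s
  obtain ⟨h1, h2, h3⟩ := h
  refine ⟨?_, ?_, ?_⟩
  · rw [c.lam_P]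
    exact (h1.mul h2).mul (h1.trans (signEq_inv_of_mul_self c.P_mul_self))
  · rwa [c.lam_Q]
  · rwa [c.lam_R]

theorem SignEq_S_conj {A B : SL(2, ℝ)} (h : SignEq A B) :
    SignEq (τ.S * A * τ.S⁻¹) (transl τ.a * B * (transl τ.a)⁻¹) :=
  ((SignEq.refl _).mul h).mul (SignEq.refl _)

theorem Represents.rho {c : Chart τ.a} {s : Triple} (h : Represents c s) :
    Represents c.shift.lam (τ.moveRho s) := by
  obtain ⟨E, F, G⟩ := s
  obtain ⟨h1, h2, h3⟩ := h
  refine ⟨?_, ?_, ?_⟩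
  · rw [Chart.lam_P]
    exact (h2.mul h3).mul (h2.trans (signEq_inv_of_mul_self c.Q_mul_self))
  · rw [Chart.lam_Q]; exact h2
  · rw [Chart.lam_R, Chart.shift_R]; exact SignEq_S_conj h1

theorem Represents.nu {c : Chart τ.a} {s : Triple} (h : Represents c s) :
    Represents c.shift.shift.lam (τ.moveNu s) := by
  obtain ⟨E, F, G⟩ := s
  obtain ⟨h1, h2, h3⟩ := h
  refine ⟨?_, ?_, ?_⟩
  · have : c.shift.shift.lam.P = (c.R * c.R) * (c.Q * c.P * c.Q⁻¹) * (c.R * c.R)⁻¹ := by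
      rw [Chart.lam_P, Chart.shift_P, Chart.shift_Q, Chart.shift_Q, Chart.shift_R, c.transl_eq]
      group
    rw [this, c.R_mul_self]
    change SignEq (F * E * F) _
    have := (h2.mul h1).mul (h2.trans (signEq_inv_of_mul_self c.Q_mul_self))
    simpa using this
  · rw [Chart.lam_Q]; exact h3
  · rw [Chart.lam_R, Chart.shift_R]; exact SignEq_S_conj h2

theorem SubtreeNode.exists_sub {r : Chart τ.a} {t s : Triple} (hr : Represents r t)
    (h : τ.SubtreeNode t s) : ∃ c, Chart.Sub r c ∧ Represents c s := by
  induction h with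
  | root => exact ⟨r, .root, hr⟩
  | lam _ ih => obtain ⟨c, hc, h⟩ := ih; exact ⟨_, hc.lam, h.lam⟩
  | rho _ ih => obtain ⟨c, hc, h⟩ := ih; exact ⟨_, hc.rho, h.rho⟩

theorem exists_subtreeNode {r c : Chart τ.a} {t : Triple} (hr : Represents r t)
    (h : Chart.Sub r c) : ∃ s, τ.SubtreeNode t s ∧ Represents c s := by
  induction h with
  | root => exact ⟨t, .root, hr⟩
  | lam _ ih => obtain ⟨c, hc, h⟩ := ih; exact ⟨_, hc.lam, h.lam⟩
  | rho _ ih => obtain ⟨c, hc, h⟩ := ih; exact ⟨_, hc.rho, h.rho⟩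

theorem IsNode.exists_node {s : Triple} (h : τ.IsNode s) :
    ∃ c, Chart.Node τ.root c ∧ Represents c s := by
  rcases h with h | h
  · obtain ⟨c, hc, h⟩ := h.exists_sub represents_root
    exact ⟨c, Or.inl hc, h⟩
  · obtain ⟨c, hc, h⟩ := h.exists_sub represents_root.nu
    exact ⟨c, Or.inr hc, h⟩

theorem exists_isNode {c : Chart τ.a} (h : Chart.Node τ.root c) :
    ∃ s, τ.IsNode s ∧ Represents c s := by
  rcases h with h | h
  · obtain ⟨s, hs, h⟩ := exists_subtreeNode represents_root h
    exact ⟨s, Or.inl hs, h⟩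
  · obtain ⟨s, hs, h⟩ := exists_subtreeNode represents_root.nu h
    exact ⟨s, Or.inr hs, h⟩

/-- Every entry of the tree is, up to sign, the first half-turn of some chart. -/
theorem Occurs.exists_reach {T : SL(2, ℝ)} (h : τ.Occurs T) :
    ∃ c, Chart.Reach τ.root c ∧ SignEq T c.P := by
  obtain ⟨E, F, G, hn, h⟩ := h
  obtain ⟨c, hc, h1, h2, h3⟩ := hn.exists_node
  rcases h with rfl | rfl | rfl
  · exact ⟨c, hc.reach, h1⟩
  · exact ⟨c.shift, hc.reach.shift, h2⟩
  · exact ⟨c.shift.shift, hc.reach.shift.shift, h3⟩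

/-- Up to sign and a translation, the first half-turn of a chart is an entry of the tree. -/
theorem Reach.exists_occurs {c : Chart τ.a} (h : Chart.Reach τ.root c) :
    ∃ T, τ.Occurs T ∧ TranslConj τ.a T c.P := by
  have e := translConj_equivalence τ.a
  obtain ⟨n, hn, k, h⟩ := h
  obtain ⟨⟨E, F, G⟩, hs, h1, h2, h3⟩ := exists_isNode hn
  rcases h with rfl | rfl | rfl <;> rw [Chart.trans_P]
  · exact ⟨E, ⟨E, F, G, hs, Or.inl rfl⟩, e.trans (h1.translConj _) (translConj_conj _ _ _)⟩
  · exact ⟨F, ⟨E, F, G, hs, Or.inr (Or.inl rfl)⟩,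
      e.trans (h2.translConj _) (translConj_conj _ _ _)⟩
  · exact ⟨G, ⟨E, F, G, hs, Or.inr (Or.inr rfl)⟩,
      e.trans (h3.translConj _) (translConj_conj _ _ _)⟩

end FrickeTriple

/-! ### The sum of the widths -/

/-- The excision width of a half-turn about a point of height `1 / z`. -/
def width (a z : ℝ) : ℝ := a - √(a ^ 2 - 4 / z ^ 2)

theorem width_nonneg {a : ℝ} (ha : 0 ≤ a) (z : ℝ) : 0 ≤ width a z := by
  have h : √(a ^ 2 - 4 / z ^ 2) ≤ √(a ^ 2) :=
    Real.sqrt_le_sqrt (by have : 0 ≤ 4 / z ^ 2 := by positivity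
                          linarith)
  rw [Real.sqrt_sq ha] at h
  exact sub_nonneg.2 h

theorem invHeight_of_signEq_turn {T : SL(2, ℝ)} {u z : ℝ} {hz : 0 < z}
    (h : SignEq T (turn u z hz)) : invHeight T = z := by
  rw [invHeight, h.abs_apply 1 0, (turn_apply u z hz).2.2.1, abs_of_pos hz]

theorem exciseWidth_eq_width (a : ℝ) (T : SL(2, ℝ)) :
    exciseWidth a T = width a (invHeight T) := rfl

/-- After squaring, the claim is `a κ ≤ α β`; squaring again, the two sides differ by `s t ≥ 0`. -/
theorem add_le_sqrt_add_sqrt {a κ s t : ℝ} (hs : 0 ≤ s) (ht : 0 ≤ t)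
    (h : κ ^ 2 = a ^ 2 - s - t) : a + κ ≤ √(a ^ 2 - s) + √(a ^ 2 - t) := by
  have hα := Real.sq_sqrt (show 0 ≤ a ^ 2 - s by nlinarith)
  have hβ := Real.sq_sqrt (show 0 ≤ a ^ 2 - t by nlinarith)
  set α := √(a ^ 2 - s)
  set β := √(a ^ 2 - t)
  have h0 : 0 ≤ α := Real.sqrt_nonneg _
  have h1 : 0 ≤ β := Real.sqrt_nonneg _
  have h2 : a * κ ≤ α * β := by
    apply le_of_sq_le_sq _ (mul_nonneg h0 h1)
    rw [mul_pow, mul_pow, hα, hβ, h]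
    nlinarith [mul_nonneg hs ht]
  apply le_of_sq_le_sq _ (add_nonneg h0 h1)
  nlinarith

namespace Chart

variable {a : ℝ} (c : Chart a)

/-- By the Markoff equation `(a x - 2) y z = x² + (y - z)²`. -/
theorem two_lt_mul_x : 2 < a * c.x := by
  have := c.hx; have := c.hy; have := c.hz
  have hyz := mul_pos c.hy c.hz
  have h : 2 * (c.y * c.z) < a * c.x * (c.y * c.z) := by
    nlinarith [c.markoff, sq_nonneg (c.y - c.z)]
  exact lt_of_mul_lt_mul_right h hyz.le

/-- The upper bound for the sum of the widths in the subtree that starts at a chart. -/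
def mass : ℝ := a - c.x / (c.y * c.z) - width a c.y / 2 - width a c.z / 2

theorem mass_nonneg : 0 ≤ c.mass := by
  have hx := c.hx; have hy := c.hy; have hz := c.hz
  have hm := c.markoff
  -- With this `κ`, the Markoff equation reads `κ² = a² - 4/y² - 4/z²`, and `a + κ` is twice the gap
  -- `x/(yz)`.
  have := add_le_sqrt_add_sqrt (a := a) (κ := 2 * (c.x / (c.y * c.z)) - a) (s := 4 / c.y ^ 2) (t := 4 / c.z ^ 2) (by positivity)
    (by positivity) (by field_simp; linear_combination 4 * hm)
  unfold mass width
  linarith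

/-- The children have gap terms `y/(xz)` and `z/(xy)`, whose sum is `a - x/(yz)`. Each child
subtracts half of the width at `x`, which the term `width a c.x` restores. -/
theorem mass_eq : c.mass = width a c.x + c.lam.mass + c.shift.lam.mass := by
  have hx := c.hx; have hy := c.hy; have hz := c.hz
  have hm := c.markoff
  have key : a - c.x / (c.y * c.z) =
      a - (c.x ^ 2 + c.z ^ 2) / c.y / (c.x * c.z) + (a - (c.y ^ 2 + c.x ^ 2) / c.z / (c.y * c.x)) := by
    field_simp
    linear_combination hm
  simp only [mass, lam, shift]
  linarith

/-- The node of the `λ`, `ρ`-tree of `c` that is reached by the moves of the list. -/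
def node : Chart a → List Bool → Chart a
  | c, [] => c
  | c, true :: l => node c.lam l
  | c, false :: l => node c.shift.lam l

theorem node_append_true (c : Chart a) (l : List Bool) : node c (l ++ [true]) = (node c l).lam := by
  induction l generalizing c with
  | nil => rfl
  | cons b l ih => cases b <;> exact ih _

theorem node_append_false (c : Chart a) (l : List Bool) :
    node c (l ++ [false]) = (node c l).shift.lam := by
  induction l generalizing c with
  | nil => rfl
  | cons b l ih => cases b <;> exact ih _

end Chart

/-- The lists of booleans of length less than `n`. -/
def shortLists : ℕ → Finset (List Bool)
  | 0 => ∅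
  | n + 1 => insert [] ((shortLists n).image (List.cons true) ∪ (shortLists n).image (List.cons false))

theorem mem_shortLists {n : ℕ} {l : List Bool} : l ∈ shortLists n ↔ l.length < n := by
  induction n generalizing l with
  | zero => simp [shortLists]
  | succ n ih =>
    cases l with
    | nil => simp [shortLists]
    | cons b l => cases b <;> simp [shortLists, ih]

theorem sum_shortLists_succ (f : List Bool → ℝ) (n : ℕ) :
    ∑ l ∈ shortLists (n + 1), f l =
      f [] + ∑ l ∈ shortLists n, f (true :: l) + ∑ l ∈ shortLists n, f (false :: l) := by
  rw [shortLists, Finset.sum_insert (by simp), Finset.sum_union, Finset.sum_image (by simp),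
    Finset.sum_image (by simp), add_assoc]
  rw [Finset.disjoint_left]
  simp

namespace Chart

variable {a : ℝ}

theorem sum_width_le (c : Chart a) (n : ℕ) :
    ∑ l ∈ shortLists n, width a (node c l).x ≤ c.mass := by
  induction n generalizing c with
  | zero => simpa [shortLists] using c.mass_nonneg
  | succ n ih =>
    rw [sum_shortLists_succ, c.mass_eq]
    exact add_le_add (add_le_add le_rfl (ih _)) (ih _)

theorem Sub.exists_node {r c : Chart a} (h : Sub r c) : ∃ l, c = node r l := by
  induction h with
  | root => exact ⟨[], rfl⟩
  | lam _ ih => obtain ⟨l, rfl⟩ := ih; exact ⟨_, (node_append_true _ _).symm⟩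
  | rho _ ih => obtain ⟨l, rfl⟩ := ih; exact ⟨_, (node_append_false _ _).symm⟩

/-- The class of a transformation modulo conjugation by powers of `w ↦ w + a`. -/
def cls (a : ℝ) (T : SL(2, ℝ)) : Quotient (translSetoid a) := Quotient.mk _ T

theorem cls_eq {A B : SL(2, ℝ)} (h : TranslConj a A B) : cls a A = cls a B := Quotient.sound h

theorem cls_conj (A : SL(2, ℝ)) : cls a (transl a * A * (transl a)⁻¹) = cls a A := by
  refine (cls_eq ?_).symm
  simpa using translConj_conj a A 1

theorem classWidth_cls_P (c : Chart a) : classWidth a (cls a c.P) = width a c.x := by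
  change exciseWidth a c.P = _
  rw [exciseWidth_eq_width, invHeight_of_signEq_turn (SignEq.refl c.P)]

/-- Each move creates one new half-turn, in first position; the other two entries are inherited up
to translation. -/
theorem Sub.cls_mem {r c : Chart a} (h : Sub r c) {X : Set (Quotient (translSetoid a))}
    (hP : cls a r.P ∈ X) (hQ : cls a r.Q ∈ X) (hR : cls a r.R ∈ X)
    (hX : ∀ b l, cls a (node r (b :: l)).P ∈ X) :
    cls a c.P ∈ X ∧ cls a c.Q ∈ X ∧ cls a c.R ∈ X := by
  have hX' : ∀ l b, cls a (node r (l ++ [b])).P ∈ X := by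
    rintro (_ | ⟨b', l⟩) b <;> exact hX _ _
  induction h with
  | root => exact ⟨hP, hQ, hR⟩
  | lam h ih =>
    obtain ⟨l, rfl⟩ := h.exists_node
    obtain ⟨h1, h2, h3⟩ := ih
    refine ⟨?_, ?_, ?_⟩
    · rw [← node_append_true]; exact hX' _ _
    · rwa [lam_Q]
    · rwa [lam_R]
  | rho h ih =>
    obtain ⟨l, rfl⟩ := h.exists_node
    obtain ⟨h1, h2, h3⟩ := ih
    refine ⟨?_, ?_, ?_⟩
    · rw [← node_append_false]; exact hX' _ _
    · rwa [lam_Q]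
    · rwa [lam_R, shift_R, cls_conj]

end Chart

namespace FrickeTriple

variable (τ : FrickeTriple)

/-- The three neighbours of the root. -/
def branch : Fin 3 → Chart τ.a :=
  ![τ.root.lam, τ.root.shift.lam, τ.root.shift.shift.lam]

/-- The charts whose first half-turns represent all classes of entries of the tree. -/
def entryChart : Fin 3 ⊕ Fin 3 × List Bool → Chart τ.a
  | Sum.inl i => ![τ.root, τ.root.shift, τ.root.shift.shift] i
  | Sum.inr (i, l) => Chart.node (τ.branch i) l

theorem sum_entryChart_le (F : Finset (Fin 3 ⊕ Fin 3 × List Bool)) :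
    ∑ i ∈ F, width τ.a (τ.entryChart i).x ≤ τ.a := by
  classical
  have ha := τ.a_pos.le
  obtain ⟨n, hn⟩ : ∃ n, ∀ i l, Sum.inr (i, l) ∈ F → l.length < n := by
    refine ⟨F.sup (Sum.elim (fun _ => 0) fun p => p.2.length) + 1, fun i l h => ?_⟩
    exact Nat.lt_succ_of_le
      (Finset.le_sup (f := Sum.elim (fun _ => 0) fun p : Fin 3 × List Bool => p.2.length) h)
  calc ∑ i ∈ F, width τ.a (τ.entryChart i).x
      ≤ ∑ i ∈ Finset.univ.disjSum (Finset.univ ×ˢ shortLists n),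
          width τ.a (τ.entryChart i).x := by
        apply Finset.sum_le_sum_of_subset_of_nonneg
        · rintro (i | ⟨i, l⟩) h
          · simp
          · simpa [mem_shortLists] using hn i l h
        · exact fun i _ _ => width_nonneg ha _
    _ = ∑ i : Fin 3, width τ.a (τ.entryChart (Sum.inl i)).x +
          ∑ i : Fin 3, ∑ l ∈ shortLists n, width τ.a (Chart.node (τ.branch i) l).x := by
        rw [Finset.sum_disjSum, Finset.sum_product]; rfl
    _ ≤ ∑ i : Fin 3, width τ.a (τ.entryChart (Sum.inl i)).x + ∑ i : Fin 3, (τ.branch i).mass := by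
        gcongr with i
        exact (τ.branch i).sum_width_le n
    _ = τ.a := by
        -- The bound is an equality here: `mass_eq` at the root accounts for two branches, and the
        -- third has the complementary gap `x/(yz)`.
        simp only [Fin.sum_univ_three]
        have h1 := τ.root.mass_eq
        have h2 : τ.root.shift.shift.lam.mass =
            τ.root.x / (τ.root.y * τ.root.z) - width τ.a τ.root.y / 2 - width τ.a τ.root.z / 2 := by
          have hx := τ.root.hx; have hy := τ.root.hy; have hz := τ.root.hz
          have hm := τ.root.markoff
          have key : τ.a - (τ.root.z ^ 2 + τ.root.y ^ 2) / τ.root.x / (τ.root.z * τ.root.y) =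
              τ.root.x / (τ.root.y * τ.root.z) := by
            field_simp
            linear_combination -hm
          simp only [Chart.mass, Chart.lam, Chart.shift] at *
          linarith
        change width τ.a τ.root.x + width τ.a τ.root.y + width τ.a τ.root.z +
          (τ.root.lam.mass + τ.root.shift.lam.mass + τ.root.shift.shift.lam.mass) = τ.a
        rw [h2]
        simp only [Chart.mass] at h1 ⊢
        linarith

theorem cls_mem_range_entryChart {T : SL(2, ℝ)} (h : τ.Occurs T) :
    ∃ i, Chart.cls τ.a (τ.entryChart i).P = Chart.cls τ.a T := by
  have hb : ∀ i l, Chart.cls τ.a (Chart.node (τ.branch i) l).P ∈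
      Set.range fun i => Chart.cls τ.a (τ.entryChart i).P := fun i l => ⟨Sum.inr (i, l), rfl⟩
  have hP : Chart.cls τ.a τ.root.P ∈ Set.range fun i => Chart.cls τ.a (τ.entryChart i).P :=
    ⟨Sum.inl 0, rfl⟩
  have hQ : Chart.cls τ.a τ.root.Q ∈ Set.range fun i => Chart.cls τ.a (τ.entryChart i).P :=
    ⟨Sum.inl 1, rfl⟩
  have hR : Chart.cls τ.a τ.root.R ∈ Set.range fun i => Chart.cls τ.a (τ.entryChart i).P :=
    ⟨Sum.inl 2, rfl⟩
  obtain ⟨E, F, G, hn, h⟩ := h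
  obtain ⟨c, hc, h1, h2, h3⟩ := hn.exists_node
  have key : Chart.cls τ.a c.P ∈ (Set.range fun i => Chart.cls τ.a (τ.entryChart i).P) ∧
      Chart.cls τ.a c.Q ∈ (Set.range fun i => Chart.cls τ.a (τ.entryChart i).P) ∧
      Chart.cls τ.a c.R ∈ (Set.range fun i => Chart.cls τ.a (τ.entryChart i).P) := by
    rcases hc with hc | hc
    · refine hc.cls_mem hP hQ hR ?_
      rintro (_ | _) l
      · exact hb 1 l
      · exact hb 0 l
    · refine hc.cls_mem (hb 2 []) ?_ ?_ fun b l => hb 2 (b :: l)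
      · rwa [Chart.lam_Q]
      · rwa [Chart.lam_R, Chart.shift_R, Chart.cls_conj]
  rcases h with rfl | rfl | rfl
  · rw [Chart.cls_eq (h1.translConj _)]; exact key.1
  · rw [Chart.cls_eq (h2.translConj _)]; exact key.2.1
  · rw [Chart.cls_eq (h3.translConj _)]; exact key.2.2

/-- The class width is summable along injective families of entries of the tree. -/
theorem summable_classWidth {ι : Type*} (q : ι → Quotient (translSetoid τ.a))
    (hq : Function.Injective q) (ho : ∀ i, q i ∈ τ.occurringClasses) :
    Summable (fun i => classWidth τ.a (q i)) ∧ ∑' i, classWidth τ.a (q i) ≤ τ.a := by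
  have hex : ∀ i, ∃ j, Chart.cls τ.a (τ.entryChart j).P = q i := by
    intro i
    obtain ⟨T, hT, h⟩ := ho i
    obtain ⟨j, hj⟩ := τ.cls_mem_range_entryChart hT
    exact ⟨j, hj.trans h.symm⟩
  choose j hj using hex
  have hinj : Function.Injective j := fun i i' h => hq (by rw [← hj, ← hj, h])
  have heq : (fun i => classWidth τ.a (q i)) = (fun i => width τ.a (τ.entryChart i).x) ∘ j := by
    funext i
    rw [← hj, Chart.classWidth_cls_P]; rfl
  have h0 : 0 ≤ fun i => width τ.a (τ.entryChart i).x := fun i => width_nonneg τ.a_pos.le _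
  have hs : Summable fun i => width τ.a (τ.entryChart i).x :=
    summable_of_sum_le h0 τ.sum_entryChart_le
  have hle : ∑' i, width τ.a (τ.entryChart i).x ≤ τ.a :=
    Real.tsum_le_of_sum_le h0 τ.sum_entryChart_le
  rw [heq]
  exact ⟨hs.comp_injective hinj, (tsum_comp_le_tsum_of_inj hs h0 hinj).trans hle⟩

end FrickeTriple

/-! ### Hyperbolicity and the action on vectors, in matrix entries -/

theorem isHyperbolic_iff (M : SL(2, ℝ)) : M.1.IsHyperbolic ↔ 4 < (M 0 0 + M 1 1) ^ 2 := by
  have h := M.2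
  have ht : M.1.trace = M 0 0 + M 1 1 := Matrix.trace_fin_two _
  rw [Matrix.IsHyperbolic, Matrix.discr_fin_two, h, ht]
  constructor <;> intro h <;> linarith

theorem mulVec_zero (M : SL(2, ℝ)) (ξ : Fin 2 → ℝ) :
    (M.1.mulVec ξ) 0 = M 0 0 * ξ 0 + M 0 1 * ξ 1 := by
  simp [Matrix.mulVec, dotProduct, Fin.sum_univ_two]

theorem mulVec_one (M : SL(2, ℝ)) (ξ : Fin 2 → ℝ) :
    (M.1.mulVec ξ) 1 = M 1 0 * ξ 0 + M 1 1 * ξ 1 := by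
  simp [Matrix.mulVec, dotProduct, Fin.sum_univ_two]

theorem mul_mulVec (M N : SL(2, ℝ)) (ξ : Fin 2 → ℝ) :
    (M * N).1.mulVec ξ = M.1.mulVec (N.1.mulVec ξ) := by
  rw [Matrix.mulVec_mulVec]; rfl

namespace Chart

variable {a : ℝ} (c : Chart a)

/-! ### Ping-pong with three quadratic forms -/

/-- The distance between the vertical sides of the ideal triangle of a chart. -/
def gap : ℝ := c.w - c.u

theorem gap_eq : c.gap = c.z / (c.x * c.y) + c.x / (c.y * c.z) := by
  simp only [gap, w, v]; ring

theorem gap_pos : 0 < c.gap := by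
  have := c.hx; have := c.hy; have := c.hz
  rw [gap_eq]; positivity

/-- The half-turns of a chart. -/
def gen : Fin 3 → SL(2, ℝ) := ![c.P, c.Q, c.R]

theorem gen_mul_self (i : Fin 3) : c.gen i * c.gen i = -1 := by
  fin_cases i
  exacts [c.P_mul_self, c.Q_mul_self, c.R_mul_self]

theorem gen_mem (i : Fin 3) : c.gen i ∈ c.group := by
  fin_cases i
  exacts [c.P_mem, c.Q_mem, c.R_mem]

/-- The quadratic forms that are positive on the vectors `(X, Y)` with `X / Y` in the intervals cut
off by the sides of the ideal triangle with vertices `∞`, `u`, `w`. -/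
def form (i : Fin 3) (ξ : Fin 2 → ℝ) : ℝ :=
  ![-(c.gap * ((ξ 0 - c.u * ξ 1) * ξ 1)), -((ξ 0 - c.u * ξ 1) * (ξ 0 - c.w * ξ 1)),
    c.gap * ((ξ 0 - c.w * ξ 1) * ξ 1)] i

/-- A linear form vanishing at the vertex at which the sides `i` and `j` meet. -/
def corner (i j : Fin 3) (ξ : Fin 2 → ℝ) : ℝ :=
  (![![0, ξ 0 - c.u * ξ 1, c.gap * ξ 1], ![ξ 0 - c.u * ξ 1, 0, ξ 0 - c.w * ξ 1],
    ![c.gap * ξ 1, ξ 0 - c.w * ξ 1, 0]] : Fin 3 → Fin 3 → ℝ) i j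

/-- The factors `gap` give all three forms the discriminant `gap²`, so that the forms of two sides
with a common vertex add up to minus a square. -/
theorem form_add_form {i j : Fin 3} (h : i ≠ j) (ξ : Fin 2 → ℝ) :
    c.form i ξ + c.form j ξ = -c.corner i j ξ ^ 2 := by
  fin_cases i <;> fin_cases j <;> first | exact absurd rfl h | skip
  all_goals simp [form, corner, gap]; ring

theorem form_add_form_nonpos {i j : Fin 3} (h : i ≠ j) (ξ : Fin 2 → ℝ) :
    c.form i ξ + c.form j ξ ≤ 0 := by
  rw [c.form_add_form h]; exact neg_nonpos.2 (sq_nonneg _)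

/-- Each half-turn is centred on its side and swaps the two ends; for `Q` this rests on `(v - u)(w -
v) = 1/y²`. -/
theorem form_gen (i : Fin 3) (ξ : Fin 2 → ℝ) :
    c.form i ((c.gen i).1.mulVec ξ) = -c.form i ξ := by
  have hx := c.hx; have hy := c.hy; have hz := c.hz
  obtain ⟨h1, h2, h3, h4⟩ := turn_apply c.u c.x c.hx
  obtain ⟨k1, k2, k3, k4⟩ := turn_apply c.v c.y c.hy
  obtain ⟨o1, o2, o3, o4⟩ := turn_apply c.w c.z c.hz
  fin_cases i
  · change -(c.gap * ((_ - c.u * _) * _)) = - -(c.gap * ((ξ 0 - c.u * ξ 1) * ξ 1))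
    rw [mulVec_zero, mulVec_one]
    change -(c.gap * ((c.P 0 0 * _ + c.P 0 1 * _ - c.u * (c.P 1 0 * _ + c.P 1 1 * _)) *
      (c.P 1 0 * _ + c.P 1 1 * _))) = _
    rw [P, h1, h2, h3, h4]
    field_simp; ring
  · change -((_ - c.u * _) * (_ - c.w * _)) = - -((ξ 0 - c.u * ξ 1) * (ξ 0 - c.w * ξ 1))
    rw [mulVec_zero, mulVec_one]
    change -((c.Q 0 0 * _ + c.Q 0 1 * _ - c.u * (c.Q 1 0 * _ + c.Q 1 1 * _)) *
      (c.Q 0 0 * _ + c.Q 0 1 * _ - c.w * (c.Q 1 0 * _ + c.Q 1 1 * _))) = _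
    rw [Q, k1, k2, k3, k4]
    simp only [w, v]
    field_simp; ring
  · change c.gap * ((_ - c.w * _) * _) = - (c.gap * ((ξ 0 - c.w * ξ 1) * ξ 1))
    rw [mulVec_zero, mulVec_one]
    change c.gap * ((c.R 0 0 * _ + c.R 0 1 * _ - c.w * (c.R 1 0 * _ + c.R 1 1 * _)) *
      (c.R 1 0 * _ + c.R 1 1 * _)) = _
    rw [R, o1, o2, o3, o4]
    field_simp; ring

theorem form_neg (i : Fin 3) (ξ : Fin 2 → ℝ) : c.form i (-ξ) = c.form i ξ := by
  fin_cases i <;> simp [form] <;> ring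

theorem form_smul (i : Fin 3) (t : ℝ) (ξ : Fin 2 → ℝ) : c.form i (t • ξ) = t ^ 2 * c.form i ξ := by
  fin_cases i <;> simp [form] <;> ring

theorem form_signEq {A B : SL(2, ℝ)} (h : SignEq A B) (i : Fin 3) (ξ : Fin 2 → ℝ) :
    c.form i (A.1.mulVec ξ) = c.form i (B.1.mulVec ξ) := by
  rcases h with rfl | rfl
  · rfl
  · rw [show (-A).1.mulVec ξ = -(A.1.mulVec ξ) from Matrix.neg_mulVec _ _, form_neg]

/-! ### Words -/

/-- The product of a word in the half-turns of a chart. -/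
def val (l : List (Fin 3)) : SL(2, ℝ) := (l.map c.gen).prod

theorem val_nil : c.val [] = 1 := rfl

theorem val_cons (i : Fin 3) (l : List (Fin 3)) : c.val (i :: l) = c.gen i * c.val l := by
  simp [val]

theorem val_append (l m : List (Fin 3)) : c.val (l ++ m) = c.val l * c.val m := by
  simp [val]

theorem val_mem (l : List (Fin 3)) : c.val l ∈ c.group := by
  induction l with
  | nil => exact one_mem _
  | cons i l ih => rw [val_cons]; exact mul_mem (c.gen_mem i) ih

/-- Ping-pong: a reduced word sends the complement of the interval of its last letter to the
interval of its first letter. -/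
theorem form_val_nonneg (i : Fin 3) (l : List (Fin 3)) (h : List.IsChain (· ≠ ·) (i :: l))
    (ξ : Fin 2 → ℝ) :
    0 ≤ c.form i ((c.val (i :: l)).1.mulVec ξ) + c.form ((i :: l).getLast (by simp)) ξ := by
  induction l generalizing i with
  | nil => rw [val_cons, val_nil, mul_one, form_gen]; simp
  | cons k l ih =>
    rw [List.isChain_cons_cons] at h
    have h1 := ih k h.2
    have h2 := c.form_add_form_nonpos h.1 ((c.val (k :: l)).1.mulVec ξ)
    rw [val_cons, mul_mulVec, form_gen, List.getLast_cons (by simp)]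
    linarith

theorem exists_val {M : SL(2, ℝ)} (h : M ∈ c.group) : ∃ l, SignEq M (c.val l) := by
  have hinv : ∀ i, SignEq (c.gen i)⁻¹ (c.val [i]) := fun i => by
    rw [val_cons, val_nil, mul_one]
    exact (signEq_inv_of_mul_self (c.gen_mul_self i)).symm
  have hl : ∀ l, ∃ m, SignEq (c.val l)⁻¹ (c.val m) := by
    intro l
    induction l with
    | nil => exact ⟨[], by simp [val_nil, SignEq]⟩
    | cons i l ih =>
      obtain ⟨m, hm⟩ := ih
      refine ⟨m ++ [i], ?_⟩
      rw [val_cons, mul_inv_rev, val_append]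
      exact hm.mul (hinv i)
  induction h using Subgroup.closure_induction with
  | mem x hx =>
    rcases hx with rfl | rfl | rfl
    · exact ⟨[0], by simp [val, gen, SignEq]⟩
    · exact ⟨[1], by simp [val, gen, SignEq]⟩
    · exact ⟨[2], by simp [val, gen, SignEq]⟩
  | one => exact ⟨[], by simp [val_nil, SignEq]⟩
  | mul x y _ _ hx hy =>
    obtain ⟨l, hl⟩ := hx
    obtain ⟨m, hm⟩ := hy
    exact ⟨l ++ m, by rw [val_append]; exact hl.mul hm⟩
  | inv x _ hx =>
    obtain ⟨l, h⟩ := hx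
    obtain ⟨m, hm⟩ := hl l
    exact ⟨m, h.inv.trans hm⟩

theorem exists_reduced (l : List (Fin 3)) :
    ∃ m, List.IsChain (· ≠ ·) m ∧ SignEq (c.val l) (c.val m) := by
  induction l with
  | nil => exact ⟨[], by simp, .refl _⟩
  | cons i l ih =>
    obtain ⟨m, hm, h⟩ := ih
    rw [val_cons]
    cases m with
    | nil => exact ⟨[i], by simp, by rw [val_cons]; exact (SignEq.refl _).mul h⟩
    | cons j m =>
      by_cases hij : i = j
      · subst hij
        refine ⟨m, hm.tail, ((SignEq.refl _).mul h).trans ?_⟩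
        rw [val_cons, ← mul_assoc, gen_mul_self]
        exact Or.inr (by simp)
      · exact ⟨i :: j :: m, by simpa [List.isChain_cons_cons] using ⟨hij, hm⟩,
          by rw [val_cons c i]; exact (SignEq.refl _).mul h⟩

/-! ### Discreteness -/

/-- A transformation in the group that sends a point inside the ideal triangle (given by two
vectors) to another one is trivial. -/
theorem signEq_one_of_form_neg {M : SL(2, ℝ)} (hM : M ∈ c.group) (ξ η : Fin 2 → ℝ)
    (h : ∀ i, c.form i ξ + c.form i η < 0)
    (h' : ∀ i, c.form i (M.1.mulVec ξ) + c.form i (M.1.mulVec η) < 0) : SignEq M 1 := by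
  obtain ⟨l, hl⟩ := c.exists_val hM
  obtain ⟨m, hm, hlm⟩ := c.exists_reduced l
  have hs := hl.trans hlm
  cases m with
  | nil => exact hs
  | cons i m =>
    -- A nonempty reduced word would make the sum of the forms at the image pair and at the original
    -- pair nonnegative, yet both are negative.
    have h1 := c.form_val_nonneg i m hm ξ
    have h2 := c.form_val_nonneg i m hm η
    have h3 := h' i
    have h4 := h ((i :: m).getLast (by simp))
    rw [c.form_signEq hs, c.form_signEq hs] at h3
    linarith

theorem transl_not_mem {t : ℝ} (h0 : 0 < t) (ht : t < c.gap) : transl t ∉ c.group := by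
  intro h
  have hd := c.gap_pos
  have hform : ∀ m : ℝ, c.u < m → m < c.w → ∀ i, c.form i ![m, 1] + c.form i ![c.gap, 0] < 0 := by
    intro m h1 h2 i
    have hg : c.gap = c.w - c.u := rfl
    have h1' := sub_pos.2 h1
    have h2' := sub_pos.2 h2
    fin_cases i <;> simp [form]
    · positivity
    · nlinarith [mul_pos h1' h2', mul_pos hd hd]
    · nlinarith [mul_pos hd h2']
  obtain ⟨k1, k2, k3, k4⟩ := transl_apply t
  have hv : ∀ p q : ℝ, (transl t).1.mulVec ![p, q] = ![p + t * q, q] := by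
    intro p q
    funext i
    fin_cases i
    · exact (mulVec_zero _ _).trans (by rw [k1, k2]; simp)
    · exact (mulVec_one _ _).trans (by rw [k3, k4]; simp)
  have hg : c.gap = c.w - c.u := rfl
  -- The vectors `(m, 1)` and `(gap, 0)` encode the point `m + i gap`, above the half-circle over
  -- `[u, w]`. Starting at `m = u + (gap - t)/2`, the translation stays in the strip.
  have := c.signEq_one_of_form_neg h ![c.u + (c.gap - t) / 2, 1] ![c.gap, 0]
    (hform _ (by linarith) (by linarith)) (by
      rw [hv, hv, mul_zero, add_zero]
      exact hform _ (by linarith) (by linarith))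
  have h2 := this.abs_apply 0 1
  rw [k2, sl_one_apply.2.1, abs_zero, abs_eq_zero] at h2
  exact h0.ne' h2

theorem a_pos {a : ℝ} (c : Chart a) : 0 < a := by
  have h := c.two_lt_mul_x
  exact pos_of_mul_pos_left (by linarith) c.hx.le

/-- Hyperbolic elements do not fix the cusp. -/
theorem apply_one_zero_ne_zero {M : SL(2, ℝ)} (hM : M ∈ c.group) (hh : M.1.IsHyperbolic) :
    M 1 0 ≠ 0 := by
  intro h0
  rw [isHyperbolic_iff] at hh
  have key : ∀ N : SL(2, ℝ), N ∈ c.group → N 1 0 = 0 → N 1 1 ^ 2 < 1 → False := by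
    intro N hN h0 hlt
    have hdet := sl_det N
    rw [h0, mul_zero, sub_zero] at hdet
    obtain ⟨i1, i2, i3, i4⟩ := sl_inv_apply N
    -- Conjugation by an element fixing `∞` scales translations by `N 1 1 ^ 2`; iterating gives
    -- translations in the group shorter than `gap`.
    have hpow : ∀ n : ℕ, transl (a * (N 1 1 ^ 2) ^ n) ∈ c.group := by
      intro n
      induction n with
      | zero => simpa using c.transl_mem
      | succ n ih =>
        have := mul_mem (mul_mem (inv_mem hN) ih) hN
        convert this using 1
        obtain ⟨k1, k2, k3, k4⟩ := transl_apply (a * (N 1 1 ^ 2) ^ n)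
        obtain ⟨l1, l2, l3, l4⟩ := transl_apply (a * (N 1 1 ^ 2) ^ (n + 1))
        apply sl_ext <;>
          simp only [sl_mul_apply, i1, i2, i3, i4, k1, k2, k3, k4, l1, l2, l3, l4, h0]
        · linear_combination -hdet
        · ring
        · ring
        · linear_combination -hdet
    obtain ⟨n, hn⟩ := exists_pow_lt_of_lt_one (div_pos c.gap_pos c.a_pos) hlt
    rw [lt_div_iff₀ c.a_pos, mul_comm] at hn
    refine c.transl_not_mem (mul_pos c.a_pos (pow_pos ?_ n)) hn (hpow n)
    have : N 1 1 ≠ 0 := fun h => by rw [h, mul_zero] at hdet; exact zero_ne_one hdet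
    positivity
  have hdet := sl_det M
  rw [h0, mul_zero, sub_zero] at hdet
  obtain ⟨i1, i2, i3, i4⟩ := sl_inv_apply M
  by_cases h1 : M 1 1 ^ 2 < 1
  · exact key M hM h0 h1
  · refine key M⁻¹ (inv_mem hM) (by rw [i3, h0, neg_zero]) ?_
    rw [i4]
    have h3 : M 0 0 ^ 2 * M 1 1 ^ 2 = 1 := by rw [← mul_pow, hdet, one_pow]
    push Not at h1
    by_contra h4
    push Not at h4
    have h5 : M 0 0 ^ 2 ≤ 1 := by nlinarith
    have h6 : M 1 1 ^ 2 ≤ 1 := by nlinarith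
    nlinarith

end Chart

/-! ### Axes -/

theorem mem_axis {M : SL(2, ℝ)} {w : ℍ} : w ∈ axis M ↔
    M 1 0 * (w.re ^ 2 + w.im ^ 2) + (M 1 1 - M 0 0) * w.re - M 0 1 = 0 := Iff.rfl

theorem axis_neg (M : SL(2, ℝ)) : axis (-M) = axis M := by
  ext w
  rw [mem_axis, mem_axis]
  simp only [sl_neg_apply]
  constructor <;> intro h <;> linear_combination -h

theorem axis_signEq {M N : SL(2, ℝ)} (h : SignEq M N) : axis M = axis N := by
  rcases h with rfl | rfl
  · rfl
  · rw [axis_neg]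

theorem axis_inv (M : SL(2, ℝ)) : axis M⁻¹ = axis M := by
  ext w
  obtain ⟨i1, i2, i3, i4⟩ := sl_inv_apply M
  rw [mem_axis, mem_axis, i1, i2, i3, i4]
  constructor <;> intro h <;> linear_combination -h

theorem smul_mem_axis (g M : SL(2, ℝ)) {w : ℍ} (hw : w ∈ axis M) :
    g • w ∈ axis (g * M * g⁻¹) := by
  have hden : ((g 1 0 : ℝ) * (w : ℂ) + (g 1 1 : ℝ)) ≠ 0 := by
    intro h
    have h1 := congrArg Complex.re h
    have h2 := congrArg Complex.im h
    simp at h1 h2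
    have hg := sl_det g
    have hi := w.im_pos.ne'
    rcases h2 with h2 | h2
    · rw [h2, zero_mul, zero_add] at h1
      rw [h1, h2] at hg
      simp at hg
    · exact hi h2
  have hc := UpperHalfPlane.coe_specialLinearGroup_apply g w
  simp only [Algebra.algebraMap_self, RingHom.id_apply] at hc
  have hn : 0 < Complex.normSq ((g 1 0 : ℝ) * (w : ℂ) + (g 1 1 : ℝ)) := Complex.normSq_pos.2 hden
  have hre : (g • w).re = (((g 0 0 : ℝ) * (w : ℂ) + (g 0 1 : ℝ)) /
      ((g 1 0 : ℝ) * (w : ℂ) + (g 1 1 : ℝ))).re := congrArg Complex.re hc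
  have him : (g • w).im = (((g 0 0 : ℝ) * (w : ℂ) + (g 0 1 : ℝ)) /
      ((g 1 0 : ℝ) * (w : ℂ) + (g 1 1 : ℝ))).im := congrArg Complex.im hc
  have hN : Complex.normSq ((g 1 0 : ℝ) * (w : ℂ) + (g 1 1 : ℝ)) =
      (g 1 0 * w.re + g 1 1) ^ 2 + (g 1 0 * w.im) ^ 2 := by
    simp [Complex.normSq_apply]; ring
  rw [hN] at hn
  rw [mem_axis] at hw ⊢
  rw [Complex.div_re, hN] at hre
  rw [Complex.div_im, hN] at him
  simp at hre him
  obtain ⟨i1, i2, i3, i4⟩ := sl_inv_apply g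
  have hg := sl_det g
  set D := (g 1 0 * w.re + g 1 1) ^ 2 + (g 1 0 * w.im) ^ 2 with hD
  have hre' : (g • w).re * D = (g 0 0 * w.re + g 0 1) * (g 1 0 * w.re + g 1 1) +
      g 0 0 * w.im * (g 1 0 * w.im) := by
    rw [hre]; field_simp
  have hsq : ((g • w).re ^ 2 + (g • w).im ^ 2) * D =
      (g 0 0 * w.re + g 0 1) ^ 2 + (g 0 0 * w.im) ^ 2 := by
    rw [hre, him]; field_simp; rw [hD]; ring
  have h0 : ((g * M * g⁻¹) 1 0 * ((g • w).re ^ 2 + (g • w).im ^ 2) +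
      ((g * M * g⁻¹) 1 1 - (g * M * g⁻¹) 0 0) * (g • w).re - (g * M * g⁻¹) 0 1) * D = 0 := by
    calc _ = (g * M * g⁻¹) 1 0 * (((g • w).re ^ 2 + (g • w).im ^ 2) * D) +
          ((g * M * g⁻¹) 1 1 - (g * M * g⁻¹) 0 0) * ((g • w).re * D) - (g * M * g⁻¹) 0 1 * D := by
            ring
      _ = (g 0 0 * g 1 1 - g 0 1 * g 1 0) ^ 2 * (M 1 0 * (w.re ^ 2 + w.im ^ 2) +
          (M 1 1 - M 0 0) * w.re - M 0 1) := by
            rw [hsq, hre', hD]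
            simp only [sl_mul_apply, i1, i2, i3, i4]
            ring
      _ = 0 := by rw [hw, mul_zero]
  exact (mul_eq_zero.1 h0).resolve_right hn.ne'

theorem smul_axis (g M : SL(2, ℝ)) : g • axis M = axis (g * M * g⁻¹) := by
  apply Set.Subset.antisymm
  · rintro _ ⟨w, hw, rfl⟩
    exact smul_mem_axis g M hw
  · intro w hw
    refine ⟨g⁻¹ • w, ?_, smul_inv_smul g w⟩
    have := smul_mem_axis g⁻¹ _ hw
    simpa [mul_assoc] using this

theorem trace_conj (g M : SL(2, ℝ)) :
    (g * M * g⁻¹) 0 0 + (g * M * g⁻¹) 1 1 = M 0 0 + M 1 1 := by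
  obtain ⟨i1, i2, i3, i4⟩ := sl_inv_apply g
  have hg := sl_det g
  simp only [sl_mul_apply, i1, i2, i3, i4]
  linear_combination (M 0 0 + M 1 1) * hg

theorem sq_trace_signEq {M N : SL(2, ℝ)} (h : SignEq M N) :
    (M 0 0 + M 1 1) ^ 2 = (N 0 0 + N 1 1) ^ 2 := by
  rcases h with rfl | rfl
  · rfl
  · simp only [sl_neg_apply]; ring

theorem trace_inv (M : SL(2, ℝ)) : M⁻¹ 0 0 + M⁻¹ 1 1 = M 0 0 + M 1 1 := by
  obtain ⟨i1, i2, i3, i4⟩ := sl_inv_apply M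
  rw [i1, i4, add_comm]

/-- `M = x + y N`. -/
def IsCombination (x y : ℝ) (M N : SL(2, ℝ)) : Prop :=
  M 0 0 = x + y * N 0 0 ∧ M 0 1 = y * N 0 1 ∧ M 1 0 = y * N 1 0 ∧ M 1 1 = x + y * N 1 1

theorem IsCombination.axis_eq {x y : ℝ} {M N : SL(2, ℝ)} (h : IsCombination x y M N)
    (hy : y ≠ 0) : axis M = axis N := by
  obtain ⟨h1, h2, h3, h4⟩ := h
  ext w
  rw [mem_axis, mem_axis, h1, h2, h3, h4]
  constructor
  · intro h
    apply mul_left_cancel₀ hy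
    linear_combination h
  · intro h
    linear_combination y * h

/-- The end points of the axis of a hyperbolic transformation. -/
theorem exists_center_radius {M : SL(2, ℝ)} (h0 : M 1 0 ≠ 0) (h : M.1.IsHyperbolic) :
    ∃ m ρ : ℝ, 0 < ρ ∧ M 1 1 - M 0 0 = -2 * M 1 0 * m ∧ M 0 1 = M 1 0 * (ρ ^ 2 - m ^ 2) := by
  rw [isHyperbolic_iff] at h
  have hdet := sl_det M
  have hpos : 0 < ((M 0 0 + M 1 1) ^ 2 - 4) / (2 * M 1 0) ^ 2 := by
    have := sub_pos.2 h
    positivity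
  refine ⟨(M 0 0 - M 1 1) / (2 * M 1 0), √(((M 0 0 + M 1 1) ^ 2 - 4) / (2 * M 1 0) ^ 2),
    Real.sqrt_pos.2 hpos, by field_simp; ring, ?_⟩
  rw [Real.sq_sqrt hpos.le]
  field_simp
  linear_combination -4 * hdet

/-- The axis determines the traceless part of a matrix up to a factor. -/
theorem exists_isCombination {M N : SL(2, ℝ)} (h0 : N 1 0 ≠ 0) (h : N.1.IsHyperbolic)
    (hax : axis M = axis N) : ∃ x y, IsCombination x y M N := by
  obtain ⟨m, ρ, hρ, h1, h2⟩ := exists_center_radius h0 h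
  have hA : (⟨⟨m, ρ⟩, hρ⟩ : ℍ) ∈ axis N := by
    rw [mem_axis]
    change N 1 0 * (m ^ 2 + ρ ^ 2) + (N 1 1 - N 0 0) * m - N 0 1 = 0
    rw [h1, h2]; ring
  -- A second point of the half-circle, from `(3/5)² + (4/5)² = 1`.
  have hB : (⟨⟨m + 3 / 5 * ρ, 4 / 5 * ρ⟩, by simpa using hρ⟩ : ℍ) ∈ axis N := by
    rw [mem_axis]
    change N 1 0 * ((m + 3 / 5 * ρ) ^ 2 + (4 / 5 * ρ) ^ 2) +
      (N 1 1 - N 0 0) * (m + 3 / 5 * ρ) - N 0 1 = 0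
    rw [h1, h2]; ring
  rw [← hax, mem_axis] at hA hB
  change M 1 0 * (m ^ 2 + ρ ^ 2) + (M 1 1 - M 0 0) * m - M 0 1 = 0 at hA
  change M 1 0 * ((m + 3 / 5 * ρ) ^ 2 + (4 / 5 * ρ) ^ 2) +
      (M 1 1 - M 0 0) * (m + 3 / 5 * ρ) - M 0 1 = 0 at hB
  have hC : M 1 1 - M 0 0 = -2 * M 1 0 * m := by
    have : (M 1 1 - M 0 0 + 2 * M 1 0 * m) * ρ = 0 := by linear_combination (5 / 3) * (hB - hA)
    linarith [(mul_eq_zero.1 this).resolve_right hρ.ne']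
  have hD : M 0 1 = M 1 0 * (ρ ^ 2 - m ^ 2) := by linear_combination m * hC - hA
  refine ⟨M 0 0 - M 1 0 / N 1 0 * N 0 0, M 1 0 / N 1 0, by ring, ?_, by field_simp, ?_⟩
  · rw [hD, h2]; field_simp
  · have e : M 1 0 / N 1 0 * (N 1 1 - N 0 0) = M 1 1 - M 0 0 := by
      rw [h1, hC]; field_simp
    linear_combination -e

/-! ### Translation lengths -/

theorem translationLength_eq (M : SL(2, ℝ)) : translationLength M =
    2 * Real.log ((|M 0 0 + M 1 1| + √(|M 0 0 + M 1 1| ^ 2 - 4)) / 2) := by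
  have ht : M.1.trace = M 0 0 + M 1 1 := Matrix.trace_fin_two _
  rw [translationLength, ht, sq_abs]

theorem translationLength_mono {M N : SL(2, ℝ)} (hM : M.1.IsHyperbolic)
    (h : (M 0 0 + M 1 1) ^ 2 ≤ (N 0 0 + N 1 1) ^ 2) :
    translationLength M ≤ translationLength N := by
  rw [isHyperbolic_iff] at hM
  rw [translationLength_eq, translationLength_eq]
  have h1 : |M 0 0 + M 1 1| ≤ |N 0 0 + N 1 1| := sq_le_sq.1 h
  have h2 : 0 < |M 0 0 + M 1 1| := abs_pos.2 fun h => by rw [h] at hM; norm_num at hM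
  gcongr

/-- With `r` the square root, `ε = z(a + r)/2` and `1/ε = z(a - r)/2`, so `1/(1 + ε²) = ε⁻¹/(ε +
ε⁻¹) = (a - r)/(2a)`. -/
theorem one_div_one_add_exp_translationLength {M : SL(2, ℝ)} {a z : ℝ} (ha : 0 < a) (hz : 0 < z)
    (h2 : 2 < a * z) (h : |M 0 0 + M 1 1| = a * z) :
    1 / (1 + Real.exp (translationLength M)) = (a - √(a ^ 2 - 4 / z ^ 2)) / (2 * a) := by
  rw [translationLength_eq, h]
  have hs : √((a * z) ^ 2 - 4) = z * √(a ^ 2 - 4 / z ^ 2) := by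
    rw [show (a * z) ^ 2 - 4 = z ^ 2 * (a ^ 2 - 4 / z ^ 2) by field_simp,
      Real.sqrt_mul (sq_nonneg z), Real.sqrt_sq hz.le]
  have hr : √(a ^ 2 - 4 / z ^ 2) ^ 2 = a ^ 2 - 4 / z ^ 2 := by
    apply Real.sq_sqrt
    rw [sub_nonneg, div_le_iff₀ (by positivity)]
    nlinarith
  set r := √(a ^ 2 - 4 / z ^ 2)
  have hr0 : 0 ≤ r := Real.sqrt_nonneg _
  rw [hs, two_mul (Real.log _), Real.exp_add, Real.exp_log (by positivity)]
  have hr' : z ^ 2 * r ^ 2 = a ^ 2 * z ^ 2 - 4 := by rw [hr]; field_simp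
  rw [div_eq_div_iff (by positivity) (by positivity)]
  have e : a * z * z * a - z * r * (z * r) = 4 := by linear_combination -hr'
  have hz2 : z ^ 2 * (a - r) * (a + r) = 4 := by linear_combination e
  linear_combination -(a + r) / 4 * hz2

/-! ### Least trace on the axis of a product of two half-turns -/

namespace Chart

variable {a : ℝ} (c : Chart a)

/-- There is no half-turn in the group about a point of the axis of `P R` between the fixed points
of `P` and `R`. -/
theorem not_mem_group_of_between {g : SL(2, ℝ)} {x y : ℝ} (hxy : 0 < x * y)
    (h : ∀ i j, g i j = x * c.P i j + y * c.R i j) : g ∉ c.group := by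
  intro hg
  have hx := c.hx; have hz := c.hz; have hd := c.gap_pos
  obtain ⟨p1, p2, p3, p4⟩ := turn_apply c.u c.x c.hx
  obtain ⟨o1, o2, o3, o4⟩ := turn_apply c.w c.z c.hz
  have h00 := h 0 0; have h01 := h 0 1; have h10 := h 1 0; have h11 := h 1 1
  rw [P, R, p1, o1] at h00
  rw [P, R, p2, o2] at h01
  rw [P, R, p3, o3] at h10
  rw [P, R, p4, o4] at h11
  have hw : c.w = c.u + c.gap := by simp [gap]
  have hdet := sl_det g
  have hdet' : x ^ 2 + y ^ 2 + x * y * (c.x * c.z * c.gap ^ 2 + c.x / c.z + c.z / c.x) = 1 := by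
    rw [h00, h01, h10, h11, hw] at hdet
    rw [← hdet]; field_simp; ring
  have hlt : x * y * (c.x * c.z * c.gap ^ 2) < 1 := by
    have : 0 < x * y * (c.x / c.z + c.z / c.x) := by positivity
    nlinarith [sq_nonneg x, sq_nonneg y]
  have hγ : 0 < y * g 1 0 ∧ 0 < x * g 1 0 := by
    rw [h10]
    constructor
    · nlinarith [mul_pos hxy hx, mul_nonneg (sq_nonneg y) hz.le]
    · nlinarith [mul_pos hxy hz, mul_nonneg (sq_nonneg x) hx.le]
  have hu : g 0 0 - c.u * g 1 0 = y * c.z * c.gap := by rw [h00, h10, hw]; ring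
  have hv : g 0 0 - c.w * g 1 0 = -(x * c.x * c.gap) := by rw [h00, h10, hw]; ring
  -- The pair `(1, 0)`, `g (1, 0)` encodes the fixed point of the half-turn `g`, since `g` permutes
  -- it up to sign. Negative sums mean that this point lies inside the triangle; for the side of `Q`
  -- this is `hlt`.
  have hform : ∀ i, c.form i ![1, 0] + c.form i ![g 0 0, g 1 0] < 0 := by
    intro i
    fin_cases i <;> simp [form]
    · rw [hu]
      have := mul_pos (mul_pos hγ.1 hz) (mul_pos hd hd)
      linarith
    · rw [hu, hv]
      linarith
    · rw [hv]
      have := mul_pos (mul_pos hγ.2 hx) (mul_pos hd hd)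
      linarith
  have hv1 : g.1.mulVec ![1, 0] = ![g 0 0, g 1 0] := by
    funext i
    fin_cases i
    · exact (mulVec_zero _ _).trans (by simp)
    · exact (mulVec_one _ _).trans (by simp)
  have htr : g 1 1 = -g 0 0 := by rw [h00, h11]; ring
  rw [htr] at hdet
  have hv2 : g.1.mulVec ![g 0 0, g 1 0] = -![1, 0] := by
    funext i
    fin_cases i
    · refine (mulVec_zero _ _).trans ?_
      simp
      linarith
    · refine (mulVec_one _ _).trans ?_
      rw [htr]
      simp
      ring
  have h1 := c.signEq_one_of_form_neg hg _ _ hform fun i => by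
    rw [hv1, hv2, form_neg, add_comm]; exact hform i
  have h3 := h1.abs_apply 1 0
  rw [sl_one_apply.2.2.1, abs_zero, abs_eq_zero] at h3
  rw [h3, mul_zero] at hγ
  exact lt_irrefl _ hγ.1

/-- Among the hyperbolic elements of the group with the axis of `P R`, the transformation `P R` has
the least trace. -/
theorem sq_trace_le {M : SL(2, ℝ)} {x y : ℝ} (hM : M ∈ c.group) (hh : M.1.IsHyperbolic)
    (hc : IsCombination x y M (c.P * c.R)) :
    ((c.P * c.R) 0 0 + (c.P * c.R) 1 1) ^ 2 ≤ (M 0 0 + M 1 1) ^ 2 := by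
  rw [isHyperbolic_iff] at hh
  obtain ⟨h1, h2, h3, h4⟩ := hc
  have hdetM := sl_det M
  have hdetN := sl_det (c.P * c.R)
  set n := (c.P * c.R) 0 0 + (c.P * c.R) 1 1 with hn
  have htr : M 0 0 + M 1 1 = 2 * x + y * n := by rw [h1, h4, hn]; ring
  have hdet : x ^ 2 + x * y * n + y ^ 2 = 1 := by
    rw [h1, h2, h3, h4] at hdetM
    rw [hn]
    linear_combination hdetM - y ^ 2 * hdetN
  have hsq : (M 0 0 + M 1 1) ^ 2 - 4 = y ^ 2 * (n ^ 2 - 4) := by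
    rw [htr]; linear_combination 4 * hdet
  have hy : y ≠ 0 := by
    rintro rfl
    norm_num at hsq
    linarith
  have hn4 : 0 < n ^ 2 - 4 := by
    have : 0 < y ^ 2 * (n ^ 2 - 4) := by rw [← hsq]; linarith
    exact pos_of_mul_pos_right this (sq_nonneg y)
  by_contra hlt
  push Not at hlt
  have hy1 : y ^ 2 < 1 := by
    by_contra h
    push Not at h
    nlinarith
  obtain ⟨i1, i2, i3, i4⟩ := sl_inv_apply M
  have hPP : ∀ i j, c.P i 0 * (c.P * c.R) 0 j + c.P i 1 * (c.P * c.R) 1 j = -c.R i j := by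
    intro i j
    rw [← sl_mul_apply, ← mul_assoc, c.P_mul_self, neg_one_mul, sl_neg_apply]
  -- `P M⁻¹ = (x + y n) P + y R` and `P M = x P - y R` lie in the group, so neither may be centred
  -- between `P` and `R`. But `x (x + y n) = 1 - y² > 0` forces one of them to be.
  have hxy : x * y ≤ 0 ∨ (x + y * n) * y ≤ 0 := by
    by_contra h
    push Not at h
    refine c.not_mem_group_of_between (g := c.P * M⁻¹) (x := x + y * n) (y := y) h.2 ?_
      (mul_mem c.P_mem (inv_mem hM))
    intro i j
    rw [sl_mul_apply]
    have := hPP i j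
    fin_cases j
    · simp only [Fin.zero_eta] at this ⊢
      rw [i1, i3, h3, h4]
      linear_combination -y * this + c.P i 0 * y * (-hn)
    · simp only [Fin.mk_one] at this ⊢
      rw [i2, i4, h1, h2]
      linear_combination -y * this + c.P i 1 * y * (-hn)
  have hx' : 0 ≤ x * y := by
    by_contra h
    push Not at h
    refine c.not_mem_group_of_between (g := c.P * M) (x := x) (y := -y) (by linarith) ?_
      (mul_mem c.P_mem hM)
    intro i j
    rw [sl_mul_apply]
    have := hPP i j
    fin_cases j
    · simp only [Fin.zero_eta] at this ⊢
      rw [h1, h3]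
      linear_combination y * this
    · simp only [Fin.mk_one] at this ⊢
      rw [h2, h4]
      linear_combination y * this
  have hp : 0 < x * (x + y * n) := by nlinarith
  have hx0 : x ≠ 0 := by rintro rfl; simp at hp
  have hxy' : 0 < x * y := lt_of_le_of_ne hx' (mul_ne_zero hx0 hy).symm
  rcases hxy with h | h
  · linarith
  · nlinarith [mul_pos hp hxy', mul_nonneg (sq_nonneg x) (neg_nonneg.2 h)]

end Chart

theorem SignEq.S_mul_signEq {a : ℝ} {c : Chart a} {T : SL(2, ℝ)} (h : SignEq T c.P) :
    SignEq (transl a * T) (c.Q * c.R)⁻¹ := by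
  have h1 : transl a * c.P = -(c.R * c.Q) := by
    rw [c.transl_eq, mul_assoc, c.P_mul_self, mul_neg_one]
  have h2 := (SignEq.refl (transl a)).mul h
  rw [h1] at h2
  have h3 := (signEq_inv_of_mul_self c.R_mul_self).mul (signEq_inv_of_mul_self c.Q_mul_self)
  rw [← mul_inv_rev] at h3
  exact h2.trans ((SignEq.neg _).symm.trans h3)

/-! ### Lengths of the geodesics of the tree -/

namespace FrickeTriple

variable {τ : FrickeTriple}

theorem S_mem : τ.S ∈ τ.group := by
  rw [← root_group]; exact τ.root.transl_mem

theorem trace_S_mul {T : SL(2, ℝ)} {u z : ℝ} {hz : 0 < z} (h : SignEq T (turn u z hz)) :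
    |(τ.S * T) 0 0 + (τ.S * T) 1 1| = τ.a * z := by
  have ha := τ.a_pos
  obtain ⟨h1, h2, h3, h4⟩ := turn_apply u z hz
  obtain ⟨k1, k2, k3, k4⟩ := transl_apply τ.a
  have hs := sq_trace_signEq ((SignEq.refl τ.S).mul h)
  have e : (τ.S * turn u z hz) 0 0 + (τ.S * turn u z hz) 1 1 = τ.a * z := by
    rw [S]
    simp only [sl_mul_apply, h1, h2, h3, h4, k1, k2, k3, k4]
    ring
  rw [e] at hs
  rw [← abs_of_pos (mul_pos ha hz)]
  exact (sq_eq_sq_iff_abs_eq_abs _ _).1 hs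

theorem Occurs.isHyperbolic {T : SL(2, ℝ)} (h : τ.Occurs T) : (τ.S * T).1.IsHyperbolic := by
  obtain ⟨c, -, hs⟩ := h.exists_reach
  rw [isHyperbolic_iff, ← sq_abs, trace_S_mul hs]
  have := c.two_lt_mul_x
  nlinarith

theorem Occurs.mem_group {T : SL(2, ℝ)} (h : τ.Occurs T) : T ∈ τ.group := by
  obtain ⟨c, hc, hs⟩ := h.exists_reach
  rw [← root_group, ← hc.group_eq]
  rcases hs.symm with rfl | rfl
  · exact c.P_mem
  · rw [← neg_one_mul]; exact mul_mem c.neg_one_mem c.P_mem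

/-- Up to sign `S T` is `(Q R)⁻¹`; passing to `braidLeft` puts `Q` and `R` into first and last
position, where `Chart.sq_trace_le` applies. -/
theorem Occurs.sq_trace_le {T M : SL(2, ℝ)} (h : τ.Occurs T) (hM : M ∈ τ.group)
    (hh : M.1.IsHyperbolic) (hax : axis M = axis (τ.S * T)) :
    ((τ.S * T) 0 0 + (τ.S * T) 1 1) ^ 2 ≤ (M 0 0 + M 1 1) ^ 2 := by
  have hhT := h.isHyperbolic
  obtain ⟨c, hc, hs⟩ := h.exists_reach
  have hST := hs.S_mul_signEq
  have hN : SignEq (τ.S * T) (c.braidLeft.P * c.braidLeft.R)⁻¹ := by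
    rwa [c.braidLeft_P, c.braidLeft_R]
  have hN' : SignEq (τ.S * T)⁻¹ (c.braidLeft.P * c.braidLeft.R) := by simpa using hN.inv
  have htr : ((τ.S * T) 0 0 + (τ.S * T) 1 1) ^ 2 =
      ((c.braidLeft.P * c.braidLeft.R) 0 0 + (c.braidLeft.P * c.braidLeft.R) 1 1) ^ 2 := by
    rw [sq_trace_signEq hN, trace_inv]
  have hmem : c.braidLeft.P * c.braidLeft.R ∈ τ.root.group := by
    rw [← hc.braidLeft.group_eq]
    exact mul_mem (Chart.P_mem _) (Chart.R_mem _)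
  have hhN : (c.braidLeft.P * c.braidLeft.R).1.IsHyperbolic := by
    rw [isHyperbolic_iff] at hhT ⊢
    rwa [← htr]
  have hax' : axis M = axis (c.braidLeft.P * c.braidLeft.R) := by
    rw [hax, ← axis_signEq hN', axis_inv]
  obtain ⟨x, y, hxy⟩ :=
    exists_isCombination (τ.root.apply_one_zero_ne_zero hmem hhN) hhN hax'
  rw [htr]
  refine c.braidLeft.sq_trace_le ?_ hh hxy
  rwa [hc.braidLeft.group_eq, root_group]

theorem geodesicLength_projAxis {T : SL(2, ℝ)} (h : τ.Occurs T) :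
    geodesicLength τ.group (projAxis τ.group (τ.S * T)) = translationLength (τ.S * T) := by
  apply IsLeast.csInf_eq
  refine ⟨⟨τ.S * T, mul_mem S_mem h.mem_group, h.isHyperbolic, MulAction.mem_orbit_self _, rfl⟩, ?_⟩
  rintro _ ⟨M, hM, hh, ⟨g, hg⟩, rfl⟩
  have hax : axis ((g : SL(2, ℝ))⁻¹ * M * (g : SL(2, ℝ))) = axis (τ.S * T) := by
    have h1 := smul_axis (g : SL(2, ℝ))⁻¹ M
    rw [inv_inv] at h1
    rw [← h1, ← hg]
    exact inv_smul_smul (g : SL(2, ℝ)) _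
  have htr := trace_conj (g : SL(2, ℝ))⁻¹ M
  rw [inv_inv] at htr
  apply translationLength_mono h.isHyperbolic
  rw [← htr]
  refine h.sq_trace_le (mul_mem (mul_mem (inv_mem g.2) hM) g.2) ?_ hax
  rw [isHyperbolic_iff] at hh ⊢
  rwa [htr]

theorem one_div_one_add_exp_geodesicLength {T : SL(2, ℝ)} (h : τ.Occurs T) :
    1 / (1 + Real.exp (geodesicLength τ.group (projAxis τ.group (τ.S * T)))) =
      exciseWidth τ.a T / (2 * τ.a) := by
  rw [geodesicLength_projAxis h]
  obtain ⟨c, -, hs⟩ := h.exists_reach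
  rw [exciseWidth_eq_width, invHeight_of_signEq_turn hs]
  exact one_div_one_add_exp_translationLength τ.a_pos c.hx c.two_lt_mul_x (trace_S_mul hs)

end FrickeTriple

/-! ### Cyclic words -/

section Lists

variable {α : Type*}

/-- No two cyclically adjacent letters agree. -/
def CyclicallyReduced (l : List α) : Prop := ∀ i m, ¬ l ~r i :: i :: m

theorem CyclicallyReduced.isChain {l l' : List α} (h : CyclicallyReduced l) (hl : l ~r l') :
    List.IsChain (· ≠ ·) l' := by
  have key : ∀ q p, l ~r p ++ q → List.IsChain (· ≠ ·) q := by
    intro q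
    induction q with
    | nil => simp
    | cons b q ih =>
      intro p hp
      cases q with
      | nil => simp
      | cons b' q =>
        rw [List.isChain_cons_cons]
        refine ⟨?_, ih (p ++ [b]) (by simpa using hp)⟩
        rintro rfl
        exact h b (q ++ p) (hp.trans List.isRotated_append)
  exact key l' [] hl

/-- A cyclic word in which every other letter is `k` is a product of blocks `k x`. -/
theorem exists_blocks {l : List α} {k : α} (hlen : 2 ≤ l.length)
    (h : ∀ x y m, l ~r x :: y :: m → (x = k ↔ y ≠ k)) :
    ∃ xs : List α, l ~r xs.flatMap (fun x => [k, x]) ∧ ∀ x ∈ xs, x ≠ k := by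
  obtain ⟨L, hL⟩ : ∃ L, l ~r k :: L := by
    match l, hlen with
    | x :: y :: m, _ =>
      by_cases hx : x = k
      · subst hx; exact ⟨_, .refl _⟩
      · have := (h x y m (.refl _)).not.1 hx
        push Not at this
        subst this
        exact ⟨m ++ [x], (List.isRotated_append (l := [x]) (l' := y :: m))⟩
  have hlen' : 2 ≤ (k :: L).length := by rwa [← hL.perm.length_eq]
  -- The blocks are peeled off a suffix `q`; the prefix `p` is kept because the hypothesis concerns
  -- rotations of the whole word.
  have key : ∀ n q p, q.length ≤ n → k :: L = p ++ q → (q = [] ∨ ∃ q', q = k :: q') →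
      ∃ xs : List α, q = xs.flatMap (fun x => [k, x]) ∧ ∀ x ∈ xs, x ≠ k := by
    intro n
    induction n with
    | zero =>
      intro q p hq _ _
      exact ⟨[], by simpa using hq, by simp⟩
    | succ n ih =>
      rintro q p hq hpq (rfl | ⟨q', rfl⟩)
      · exact ⟨[], rfl, by simp⟩
      have hrot : l ~r k :: q' ++ p := by
        have h1 : l ~r p ++ k :: q' := by rw [← hpq]; exact hL
        exact h1.trans List.isRotated_append
      cases q' with
      | nil =>
        cases p with
        | nil => rw [hpq] at hlen'; simp at hlen'
        | cons b p =>
          have hb : k = b := by simpa using congrArg List.head? hpq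
          exact absurd hb.symm ((h k b p hrot).1 rfl)
      | cons x t =>
        have hx : x ≠ k := (h k x (t ++ p) hrot).1 rfl
        have hpq' : k :: L = (p ++ [k, x]) ++ t := by simpa using hpq
        obtain ⟨xs, hxs, hk⟩ := ih t (p ++ [k, x]) (by simp at hq; omega) hpq' (by
          cases t with
          | nil => exact Or.inl rfl
          | cons y t =>
            have hrot' : l ~r x :: y :: (t ++ (p ++ [k])) := by
              refine hrot.trans ?_
              have := List.isRotated_append (l := [k]) (l' := x :: y :: t ++ p)
              simpa using this
            have := (h x y _ hrot').not.1 hx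
            push Not at this
            exact Or.inr ⟨t, by rw [this]⟩)
        refine ⟨x :: xs, by simp [hxs], ?_⟩
        simp only [List.mem_cons, forall_eq_or_imp]
        exact ⟨hx, hk⟩
  obtain ⟨xs, hxs, hk⟩ := key _ (k :: L) [] le_rfl rfl (Or.inr ⟨L, rfl⟩)
  exact ⟨xs, by rw [← hxs]; exact hL, hk⟩

theorem exists_adjacent {i j : α} {xs : List α} (h : ∀ x ∈ xs, x = i ∨ x = j) :
    (∃ n, xs = List.replicate n i) ∨ (∃ n, xs = List.replicate n j) ∨
      ∃ p q ys, xs = p ++ q ∧ q ++ p = i :: j :: ys := by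
  have key : (∃ p q, xs = p ++ i :: j :: q) ∨
      ∃ p q, xs = List.replicate p j ++ List.replicate q i := by
    induction xs with
    | nil => exact Or.inr ⟨0, 0, rfl⟩
    | cons x xs ih =>
      have hx := h x (by simp)
      rcases ih fun y hy => h y (by simp [hy]) with ⟨p, q, rfl⟩ | ⟨p, q, rfl⟩
      · exact Or.inl ⟨x :: p, q, rfl⟩
      rcases hx with rfl | rfl
      · cases p with
        | zero => exact Or.inr ⟨0, q + 1, by simp [List.replicate_succ]⟩
        | succ p => exact Or.inl ⟨[], List.replicate p j ++ List.replicate q x,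
            by simp [List.replicate_succ]⟩
      · exact Or.inr ⟨p + 1, q, by simp [List.replicate_succ]⟩
  rcases key with ⟨p, q, rfl⟩ | ⟨p, q, rfl⟩
  · exact Or.inr (Or.inr ⟨p, i :: j :: q, q ++ p, rfl, rfl⟩)
  cases q with
  | zero => exact Or.inr (Or.inl ⟨p, by simp⟩)
  | succ q =>
    cases p with
    | zero => exact Or.inl ⟨q + 1, by simp⟩
    | succ p =>
      refine Or.inr (Or.inr ⟨List.replicate (p + 1) j ++ List.replicate q i, [i],
        List.replicate p j ++ List.replicate q i, ?_, ?_⟩)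
      · rw [List.append_assoc, ← List.replicate_succ']
      · simp [List.replicate_succ]

/-- A cyclically reduced word in the letters `i`, `j`, `k` in which `i` and `j` are never adjacent
is a power of `k i` or of `k j`, or it contains `k i k j`. -/
theorem CyclicallyReduced.cases {l : List α} (h : CyclicallyReduced l) (hlen : 2 ≤ l.length)
    {i j k : α} (hij : i ≠ j) (hik : i ≠ k) (hjk : j ≠ k) (hall : ∀ x, x = i ∨ x = j ∨ x = k)
    (h1 : ∀ m, ¬ l ~r i :: j :: m) (h2 : ∀ m, ¬ l ~r j :: i :: m) :
    (∃ x n, (x = i ∨ x = j) ∧ l ~r (List.replicate n x).flatMap (fun x => [k, x])) ∨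
      ∃ ys : List α, (∀ y ∈ ys, y = i ∨ y = j) ∧
        l ~r (i :: j :: ys).flatMap (fun x => [k, x]) := by
  obtain ⟨xs, hxs, hk⟩ := exists_blocks (k := k) hlen (by
    intro x y m hm
    rcases hall x with rfl | rfl | rfl <;> rcases hall y with rfl | rfl | rfl
    · exact absurd hm (h _ _)
    · exact absurd hm (h1 _)
    · simp [hik]
    · exact absurd hm (h2 _)
    · exact absurd hm (h _ _)
    · simp [hjk]
    · simp [hik]
    · simp [hjk]
    · exact absurd hm (h _ _))
  have hmem : ∀ x ∈ xs, x = i ∨ x = j := fun x hx => by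
    rcases hall x with h | h | h
    · exact Or.inl h
    · exact Or.inr h
    · exact absurd h (hk x hx)
  rcases exists_adjacent hmem with ⟨n, rfl⟩ | ⟨n, rfl⟩ | ⟨p, q, ys, rfl, hpq⟩
  · exact Or.inl ⟨i, n, Or.inl rfl, hxs⟩
  · exact Or.inl ⟨j, n, Or.inr rfl, hxs⟩
  · refine Or.inr ⟨ys, fun y hy => hmem y ?_, ?_⟩
    · have : y ∈ q ++ p := by rw [hpq]; simp [hy]
      simpa [or_comm] using this
    · rw [← hpq, List.flatMap_append]
      rw [List.flatMap_append] at hxs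
      exact hxs.trans List.isRotated_append

end Lists

/-! ### Conjugating and shortening words -/

namespace Chart

variable {a : ℝ} (c : Chart a)

theorem val_isRotated {l l' : List (Fin 3)} (h : l ~r l') :
    ∃ g ∈ c.group, c.val l' = g * c.val l * g⁻¹ := by
  obtain ⟨n, rfl⟩ := h
  induction n generalizing l with
  | zero => exact ⟨1, one_mem _, by simp⟩
  | succ n ih =>
    cases l with
    | nil => exact ⟨1, one_mem _, by simp⟩
    | cons i l =>
      obtain ⟨g, hg, h⟩ := ih (l := l ++ [i])
      refine ⟨g * (c.gen i)⁻¹, mul_mem hg (inv_mem (c.gen_mem i)), ?_⟩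
      rw [List.rotate_cons_succ, h, val_append, val_cons, val_cons, val_nil]
      group

theorem val_flatMap_replicate (k x : Fin 3) (n : ℕ) :
    c.val ((List.replicate n x).flatMap (fun x => [k, x])) = (c.gen k * c.gen x) ^ n := by
  induction n with
  | zero => rfl
  | succ n ih =>
    rw [List.replicate_succ, List.flatMap_cons, val_append, ih, pow_succ', val_cons, val_cons,
      val_nil, mul_one]

variable {c} in
/-- A word that contains `k i k j` and consists of blocks `k i` and `k j` gets shorter when `i` is
moved across `k`. -/
theorem exists_shorter {c' : Chart a} {i j k i' j' k' : Fin 3} (hij : i ≠ j)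
    (hi : SignEq (c.gen k * c.gen i * c.gen k) (c'.gen i'))
    (hj : SignEq (c.gen j) (c'.gen j')) (hk : SignEq (c.gen k) (c'.gen k'))
    {ys : List (Fin 3)} (hys : ∀ y ∈ ys, y = i ∨ y = j) :
    ∃ l : List (Fin 3), l.length < ((i :: j :: ys).flatMap (fun x => [k, x])).length ∧
      SignEq (c.val ((i :: j :: ys).flatMap (fun x => [k, x]))) (c'.val l) := by
  have hki : SignEq (c.gen k * c.gen i) (c'.gen i' * c'.gen k') := by
    refine SignEq.trans (SignEq.neg _) ?_
    have : -(c.gen k * c.gen i) = c.gen k * c.gen i * c.gen k * c.gen k := by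
      rw [mul_assoc _ (c.gen k), gen_mul_self, mul_neg_one]
    rw [this]
    exact hi.mul hk
  have hblocks : ∃ m : List (Fin 3), m.length = 2 * ys.length ∧
      SignEq (c.val (ys.flatMap (fun x => [k, x]))) (c'.val m) := by
    induction ys with
    | nil => exact ⟨[], by simp, by rw [List.flatMap_nil, val_nil, val_nil]; exact .refl _⟩
    | cons y ys ih =>
      obtain ⟨m, hm, h⟩ := ih fun z hz => hys z (by simp [hz])
      rcases hys y (by simp) with rfl | rfl
      · refine ⟨i' :: k' :: m, by simp [hm]; ring, ?_⟩
        simp only [List.flatMap_cons, val_append, val_cons, val_nil, mul_one]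
        rw [← mul_assoc]
        exact hki.mul h
      · refine ⟨k' :: j' :: m, by simp [hm]; ring, ?_⟩
        simp only [List.flatMap_cons, val_append, val_cons, val_nil, mul_one]
        rw [← mul_assoc]
        exact (hk.mul hj).mul h
  obtain ⟨m, hm, h⟩ := hblocks
  -- The leading `k i k j` collapses to `i' j'`, while later blocks keep length two: `k i` becomes
  -- `i' k'` and `k j` becomes `k' j'`, up to sign.
  refine ⟨i' :: j' :: m, ?_, ?_⟩
  · simp [hm, List.length_flatMap]; omega
  · simp only [List.flatMap_cons, val_append, val_cons, val_nil, mul_one]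
    have : c.gen k * c.gen i * (c.gen k * c.gen j * c.val (ys.flatMap fun x => [k, x])) =
        (c.gen k * c.gen i * c.gen k) * (c.gen j * c.val (ys.flatMap fun x => [k, x])) := by
      group
    rw [this]
    exact hi.mul (hj.mul h)

end Chart

/-! ### Half-circles -/

/-- The half-circle with end points `p` and `q`. -/
def halfCircle (p q : ℝ) : Set ℍ := {w | (w.re - p) * (w.re - q) + w.im ^ 2 = 0}

theorem halfCircle_comm (p q : ℝ) : halfCircle p q = halfCircle q p := by
  ext w; simp only [halfCircle, Set.mem_ofPred_eq, mul_comm]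

theorem mem_halfCircle {p q s t : ℝ} (ht : 0 < t) :
    (⟨⟨s, t⟩, ht⟩ : ℍ) ∈ halfCircle p q ↔ (s - p) * (s - q) + t ^ 2 = 0 := Iff.rfl

theorem transl_smul_halfCircle (t p q : ℝ) :
    transl t • halfCircle p q = halfCircle (p + t) (q + t) := by
  have key : ∀ (t : ℝ) (w : ℍ), (transl t • w).re = w.re + t ∧ (transl t • w).im = w.im := by
    intro t w
    obtain ⟨k1, k2, k3, k4⟩ := transl_apply t
    have hc := UpperHalfPlane.coe_specialLinearGroup_apply (transl t) w
    simp only [Algebra.algebraMap_self, RingHom.id_apply, k1, k2, k3, k4] at hc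
    have h1 := congrArg Complex.re hc
    have h2 := congrArg Complex.im hc
    simp at h1 h2
    exact ⟨h1, h2⟩
  have hsub : ∀ t p q : ℝ, transl t • halfCircle p q ⊆ halfCircle (p + t) (q + t) := by
    rintro t p q _ ⟨w, hw, rfl⟩
    change ((transl t • w).re - _) * ((transl t • w).re - _) + (transl t • w).im ^ 2 = 0
    rw [(key t w).1, (key t w).2]
    have : (w.re - p) * (w.re - q) + w.im ^ 2 = 0 := hw
    linear_combination this
  refine Set.Subset.antisymm (hsub t p q) ?_
  rw [Set.subset_smul_set_iff, ← transl_neg]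
  have := hsub (-t) (p + t) (q + t)
  simpa using this

/-- Two half-circles whose end points are interlaced cross. -/
theorem not_disjoint_halfCircle {p q p' q' : ℝ} (h1 : p < p') (h2 : p' < q) (h3 : q < q') :
    ¬ Disjoint (halfCircle p q) (halfCircle p' q') ∧ halfCircle p q ≠ halfCircle p' q' := by
  have hD : 0 < p' + q' - p - q := by linarith
  constructor
  · rw [Set.not_disjoint_iff]
    have h4 : 0 < (p' - p) * (q' - p) * ((q' - q) * (q - p')) / (p' + q' - p - q) ^ 2 := by
      have := sub_pos.2 h1; have := sub_pos.2 h2; have := sub_pos.2 h3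
      have : 0 < q' - p := by linarith
      positivity
    have h5 := Real.sqrt_pos.2 h4
    -- Subtracting the two circle equations leaves a linear equation for the real part.
    refine ⟨⟨⟨(p' * q' - p * q) / (p' + q' - p - q), _⟩, h5⟩, ?_, ?_⟩ <;>
      rw [mem_halfCircle, Real.sq_sqrt h4.le] <;> field_simp <;> ring
  · intro h
    have h4 : 0 < (q - p) ^ 2 / 4 := by have := sub_pos.2 (h1.trans h2); positivity
    have h5 : 0 < 2 * (q - p) ^ 2 / 9 := by have := sub_pos.2 (h1.trans h2); positivity
    have hA : (⟨⟨(p + q) / 2, _⟩, Real.sqrt_pos.2 h4⟩ : ℍ) ∈ halfCircle p q := by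
      rw [mem_halfCircle, Real.sq_sqrt h4.le]; ring
    have hB : (⟨⟨(2 * p + q) / 3, _⟩, Real.sqrt_pos.2 h5⟩ : ℍ) ∈ halfCircle p q := by
      rw [mem_halfCircle, Real.sq_sqrt h5.le]; ring
    rw [h, mem_halfCircle, Real.sq_sqrt h4.le] at hA
    rw [h, mem_halfCircle, Real.sq_sqrt h5.le] at hB
    have : (p' + q' - p - q) * (q - p) = 0 := by linear_combination 6 * (hB - hA)
    rcases mul_eq_zero.1 this with h | h <;> linarith

/-- Both half-circles pass over `t`, so if they were not nested their end points would interlace. -/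
theorem nested_of_pairwiseDisjoint {γ : Set (Set ℍ)} (hγ : γ.PairwiseDisjoint id)
    {p q p' q' t : ℝ} (h : halfCircle p q ∈ γ) (h' : halfCircle p' q' ∈ γ)
    (h1 : p < t) (h2 : t < q) (h3 : p' < t) (h4 : t < q') :
    (p ≤ p' ∧ q' ≤ q) ∨ (p' ≤ p ∧ q ≤ q') := by
  by_contra hn
  push Not at hn
  rcases le_total p p' with hp | hp
  · have hq := hn.1 hp
    rcases hp.lt_or_eq with hp | rfl
    · have := not_disjoint_halfCircle hp (h3.trans h2) hq
      exact this.1 (hγ h h' this.2)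
    · linarith [hn.2 le_rfl]
  · have hq := hn.2 hp
    rcases hp.lt_or_eq with hp | rfl
    · have := not_disjoint_halfCircle hp (h1.trans h4) hq
      exact this.1 (hγ h' h this.2)
    · linarith [hn.1 le_rfl]

/-- A family of disjoint half-circles that is invariant under a translation cannot cover a whole
fan of ideal triangles. -/
theorem false_of_fan {γ : Set (Set ℍ)} (hγ : γ.PairwiseDisjoint id) {a r s t : ℝ}
    (hS : ∀ p q, halfCircle p q ∈ γ → halfCircle (p + a) (q + a) ∈ γ)
    (hrs : r < s) (hst : s < t) (hta : t < r + a)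
    {p₁ q₁ p₂ q₂ p₃ q₃ : ℝ} (h₁ : halfCircle p₁ q₁ ∈ γ) (h₂ : halfCircle p₂ q₂ ∈ γ)
    (h₃ : halfCircle p₃ q₃ ∈ γ) (hp₁ : p₁ < r) (hq₁ : s < q₁) (hp₂ : p₂ < s) (hq₂ : t < q₂)
    (hp₃ : p₃ < t) (hq₃ : r + a < q₃) : False := by
  obtain ⟨p, q, h, hp, hq⟩ : ∃ p q, halfCircle p q ∈ γ ∧ p < r ∧ t < q := by
    rcases nested_of_pairwiseDisjoint hγ h₁ h₂ (hp₁.trans hrs) hq₁ hp₂ (hst.trans hq₂) with h | h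
    · exact ⟨p₁, q₁, h₁, hp₁, hq₂.trans_le h.2⟩
    · exact ⟨p₂, q₂, h₂, h.1.trans_lt hp₁, hq₂⟩
  obtain ⟨p, q, h, hp, hq⟩ : ∃ p q, halfCircle p q ∈ γ ∧ p < r ∧ r + a < q := by
    rcases nested_of_pairwiseDisjoint hγ h h₃ (hp.trans (hrs.trans hst)) hq hp₃ (hta.trans hq₃)
      with h' | h'
    · exact ⟨p, q, h, hp, hq₃.trans_le h'.2⟩
    · exact ⟨p₃, q₃, h₃, h'.1.trans_lt hp, hq₃⟩
  -- This half-circle and its translate by `a` both pass over `r + a`, but neither can contain the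
  -- other.
  rcases nested_of_pairwiseDisjoint hγ h (hS p q h) (t := r + a) (by linarith) hq (by linarith)
    (by linarith) with h' | h' <;> linarith

/-! ### Eigenvectors -/

/-- Choosing `e` of modulus above one makes its eigenvector the attracting fixed point. -/
theorem exists_eigenvalue {M : SL(2, ℝ)} (h : M.1.IsHyperbolic) :
    ∃ e f : ℝ, 1 < e ^ 2 ∧ e * f = 1 ∧ e + f = M 0 0 + M 1 1 := by
  rw [isHyperbolic_iff] at h
  set t := M 0 0 + M 1 1
  have hr := Real.sq_sqrt (sub_nonneg.2 h.le)
  have hr0 := Real.sqrt_pos.2 (sub_pos.2 h)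
  set r := √(t ^ 2 - 4)
  rcases le_total 0 t with ht | ht
  · exact ⟨(t + r) / 2, (t - r) / 2, by nlinarith, by linear_combination -hr / 4, by ring⟩
  · exact ⟨(t - r) / 2, (t + r) / 2, by nlinarith, by linear_combination -hr / 4, by ring⟩

theorem mulVec_eigenvector {M : SL(2, ℝ)} (h0 : M 1 0 ≠ 0) {e f : ℝ} (hef : e * f = 1)
    (htr : e + f = M 0 0 + M 1 1) :
    M.1.mulVec ![(e - M 1 1) / M 1 0, 1] = e • ![(e - M 1 1) / M 1 0, 1] := by
  have hdet := sl_det M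
  funext i
  fin_cases i
  · refine (mulVec_zero _ _).trans ?_
    simp
    field_simp
    linear_combination hef - hdet - e * htr
  · refine (mulVec_one _ _).trans ?_
    simp
    field_simp
    ring

theorem axis_eq_halfCircle {M : SL(2, ℝ)} (h0 : M 1 0 ≠ 0) {e f : ℝ} (hef : e * f = 1)
    (htr : e + f = M 0 0 + M 1 1) :
    axis M = halfCircle ((e - M 1 1) / M 1 0) ((f - M 1 1) / M 1 0) := by
  have hdet := sl_det M
  ext w
  have key : M 1 0 * ((w.re - (e - M 1 1) / M 1 0) * (w.re - (f - M 1 1) / M 1 0) + w.im ^ 2) =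
      M 1 0 * (w.re ^ 2 + w.im ^ 2) + (M 1 1 - M 0 0) * w.re - M 0 1 := by
    field_simp
    linear_combination hef - hdet - (M 1 1 + w.re * M 1 0) * htr
  rw [mem_axis, ← key]
  change _ ↔ _ = 0
  simp [h0]

namespace Chart

variable {a : ℝ} (c : Chart a)

theorem isHyperbolic_conj {g M : SL(2, ℝ)} (h : M.1.IsHyperbolic) :
    (g * M * g⁻¹).1.IsHyperbolic := by
  rw [isHyperbolic_iff] at h ⊢
  rwa [trace_conj]

theorem eigenvector_one_ne_zero {M : SL(2, ℝ)} (hM : M ∈ c.group) (hh : M.1.IsHyperbolic)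
    {e : ℝ} {ξ : Fin 2 → ℝ} (hξ : ξ ≠ 0) (h : M.1.mulVec ξ = e • ξ) : ξ 1 ≠ 0 := by
  intro h0
  have h1 := congrFun h 1
  rw [mulVec_one, h0] at h1
  simp [h0] at h1
  rcases h1 with h1 | h1
  · exact c.apply_one_zero_ne_zero hM hh h1
  · exact hξ (by funext i; fin_cases i <;> assumption)

theorem eigenvector_conj {g M : SL(2, ℝ)} {e : ℝ} {ξ : Fin 2 → ℝ}
    (h : M.1.mulVec ξ = e • ξ) :
    (g * M * g⁻¹).1.mulVec (g.1.mulVec ξ) = e • g.1.mulVec ξ := by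
  rw [← mul_mulVec, inv_mul_cancel_right, mul_mulVec, h, Matrix.mulVec_smul]

theorem mulVec_ne_zero {g : SL(2, ℝ)} {ξ : Fin 2 → ℝ} (h : ξ ≠ 0) : g.1.mulVec ξ ≠ 0 := by
  intro h0
  apply h
  have := congrArg (g⁻¹.1.mulVec) h0
  rwa [← mul_mulVec, inv_mul_cancel, Matrix.mulVec_zero, Matrix.SpecialLinearGroup.coe_one,
    Matrix.one_mulVec] at this

/-- The fixed points of hyperbolic elements are not vertices of the ideal triangle. -/
theorem corner_ne_zero {M : SL(2, ℝ)} (hM : M ∈ c.group) (hh : M.1.IsHyperbolic)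
    {e : ℝ} {ξ : Fin 2 → ℝ} (hξ : ξ ≠ 0) (h : M.1.mulVec ξ = e • ξ) {i j : Fin 3} (hij : i ≠ j) :
    c.corner i j ξ ≠ 0 := by
  have h1 := c.eigenvector_one_ne_zero hM hh hξ h
  -- The vertices `u` and `w` are sent to the cusp by `P` and `R`, so it is enough that no conjugate
  -- of `M` fixes `∞`.
  have key : ∀ g ∈ c.group, (g.1.mulVec ξ) 1 ≠ 0 := fun g hg =>
    c.eigenvector_one_ne_zero (mul_mem (mul_mem hg hM) (inv_mem hg)) (isHyperbolic_conj hh)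
      (mulVec_ne_zero hξ) (eigenvector_conj h)
  have hu : ξ 0 - c.u * ξ 1 ≠ 0 := by
    have h2 := key _ c.P_mem
    obtain ⟨p1, p2, p3, p4⟩ := turn_apply c.u c.x c.hx
    rw [mulVec_one, P, p3, p4] at h2
    intro h3
    apply h2
    linear_combination c.x * h3
  have hw : ξ 0 - c.w * ξ 1 ≠ 0 := by
    have h2 := key _ c.R_mem
    obtain ⟨p1, p2, p3, p4⟩ := turn_apply c.w c.z c.hz
    rw [mulVec_one, R, p3, p4] at h2
    intro h3
    apply h2
    linear_combination c.z * h3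
  have hg := c.gap_pos.ne'
  fin_cases i <;> fin_cases j <;> first | exact absurd rfl hij | skip
  all_goals simp [corner]
  all_goals first | exact hu | exact hw | exact ⟨hg, h1⟩

/-- The fixed points of a reduced word lie in the intervals of its first and its last letter. -/
theorem exists_axis_conj {M g : SL(2, ℝ)} (hM : M ∈ c.group) (hh : M.1.IsHyperbolic)
    (hg : g ∈ c.group) {i j : Fin 3} (hij : i ≠ j)
    (hK : ∀ ξ, 0 ≤ c.form i (M.1.mulVec ξ) + c.form j ξ) :
    ∃ p q, axis (g * M * g⁻¹) = halfCircle p q ∧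
      0 < c.form i (g⁻¹.1.mulVec ![p, 1]) ∧ 0 < c.form j (g⁻¹.1.mulVec ![q, 1]) := by
  have hN : g * M * g⁻¹ ∈ c.group := mul_mem (mul_mem hg hM) (inv_mem hg)
  have hhN : (g * M * g⁻¹).1.IsHyperbolic := isHyperbolic_conj hh
  have h0 := c.apply_one_zero_ne_zero hN hhN
  obtain ⟨e, f, he, hef, htr⟩ := exists_eigenvalue hhN
  have hback : ∀ {e : ℝ} {ξ : Fin 2 → ℝ}, (g * M * g⁻¹).1.mulVec ξ = e • ξ →
      M.1.mulVec (g⁻¹.1.mulVec ξ) = e • g⁻¹.1.mulVec ξ := by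
    intro e ξ h
    have := eigenvector_conj (g := g⁻¹) h
    rwa [show g⁻¹ * (g * M * g⁻¹) * g⁻¹⁻¹ = M by group] at this
  have hne : ∀ p : ℝ, (![p, 1] : Fin 2 → ℝ) ≠ 0 := fun p h => by simpa using congrFun h 1
  refine ⟨_, _, axis_eq_halfCircle h0 hef htr, ?_, ?_⟩
  · have h1 := hback (mulVec_eigenvector h0 hef htr)
    have h2 := c.corner_ne_zero hM hh (mulVec_ne_zero (hne _)) h1 hij
    have h3 := c.form_add_form hij (g⁻¹.1.mulVec ![(e - (g * M * g⁻¹) 1 1) / (g * M * g⁻¹) 1 0, 1])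
    have h4 := hK (g⁻¹.1.mulVec ![(e - (g * M * g⁻¹) 1 1) / (g * M * g⁻¹) 1 0, 1])
    rw [h1, form_smul] at h4
    have h5 := pow_pos (abs_pos.2 h2) 2
    rw [sq_abs] at h5
    -- `e² form_i + form_j ≥ 0` and `form_i + form_j < 0` at the eigenvector; subtract.
    refine pos_of_mul_pos_right (a := e ^ 2 - 1) ?_ (by linarith)
    linarith
  · have h1 := hback (mulVec_eigenvector h0 (by rwa [mul_comm]) (by rwa [add_comm]))
    have h2 := c.corner_ne_zero hM hh (mulVec_ne_zero (hne _)) h1 hij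
    have h3 := c.form_add_form hij (g⁻¹.1.mulVec ![(f - (g * M * g⁻¹) 1 1) / (g * M * g⁻¹) 1 0, 1])
    have h4 := hK (g⁻¹.1.mulVec ![(f - (g * M * g⁻¹) 1 1) / (g * M * g⁻¹) 1 0, 1])
    rw [h1, form_smul] at h4
    have h5 := pow_pos (abs_pos.2 h2) 2
    rw [sq_abs] at h5
    have h6 : e ^ 2 * f ^ 2 = 1 := by rw [← mul_pow, hef, one_pow]
    have h7 := mul_nonneg (sq_nonneg e) h4
    rw [mul_add, ← mul_assoc, h6, one_mul] at h7
    refine pos_of_mul_pos_right (a := e ^ 2 - 1) ?_ (by linarith)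
    linarith

end Chart

/-! ### Projections of axes -/

theorem axis_conj_mem_projAxis {Γ : Subgroup SL(2, ℝ)} {g : SL(2, ℝ)} (hg : g ∈ Γ)
    (M : SL(2, ℝ)) : axis (g * M * g⁻¹) ∈ projAxis Γ M := by
  rw [← smul_axis]
  exact ⟨⟨g, hg⟩, rfl⟩

theorem projAxis_congr (Γ : Subgroup SL(2, ℝ)) {M N : SL(2, ℝ)} (h : axis M = axis N) :
    projAxis Γ M = projAxis Γ N := by
  rw [projAxis, projAxis, h]

theorem projAxis_conj {Γ : Subgroup SL(2, ℝ)} {g : SL(2, ℝ)} (hg : g ∈ Γ) (M : SL(2, ℝ)) :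
    projAxis Γ (g * M * g⁻¹) = projAxis Γ M :=
  MulAction.orbit_eq_iff.2 (axis_conj_mem_projAxis hg M)

theorem smul_mem_projAxis {Γ : Subgroup SL(2, ℝ)} {g : SL(2, ℝ)} (hg : g ∈ Γ) {M : SL(2, ℝ)}
    {A : Set ℍ} (hA : A ∈ projAxis Γ M) : g • A ∈ projAxis Γ M :=
  MulAction.mem_orbit_of_mem_orbit (⟨g, hg⟩ : Γ) hA

/-- Cayley–Hamilton: `N² = (tr N) N - 1`. -/
theorem isCombination_pow (N : SL(2, ℝ)) (n : ℕ) : ∃ x y, IsCombination x y (N ^ n) N := by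
  induction n with
  | zero => exact ⟨1, 0, by simp [IsCombination]⟩
  | succ n ih =>
    obtain ⟨x, y, h1, h2, h3, h4⟩ := ih
    have hdet := sl_det N
    refine ⟨-y, x + y * (N 0 0 + N 1 1), ?_⟩
    rw [pow_succ]
    simp only [IsCombination, sl_mul_apply, h1, h2, h3, h4]
    refine ⟨?_, ?_, ?_, ?_⟩
    · linear_combination -y * hdet
    · ring
    · ring
    · linear_combination -y * hdet

theorem axis_pow {N : SL(2, ℝ)} {n : ℕ} (h : (N ^ n).1.IsHyperbolic) :
    axis (N ^ n) = axis N := by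
  obtain ⟨x, y, hc⟩ := isCombination_pow N n
  refine hc.axis_eq ?_
  rintro rfl
  obtain ⟨h1, h2, h3, h4⟩ := hc
  have hdet := sl_det (N ^ n)
  rw [isHyperbolic_iff] at h
  rw [h1, h2, h3, h4] at hdet
  rw [h1, h4] at h
  nlinarith

/-! ### Axes crossing the ideal triangle -/

namespace Chart

variable {a : ℝ} (c : Chart a)

theorem exists_axis_conj_of_or {M g : SL(2, ℝ)} (hM : M ∈ c.group) (hh : M.1.IsHyperbolic)
    (hg : g ∈ c.group) {i j : Fin 3} (hij : i ≠ j)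
    (hK : (∀ ξ, 0 ≤ c.form i (M.1.mulVec ξ) + c.form j ξ) ∨
      ∀ ξ, 0 ≤ c.form j (M.1.mulVec ξ) + c.form i ξ) :
    ∃ p q, axis (g * M * g⁻¹) = halfCircle p q ∧
      0 < c.form i (g⁻¹.1.mulVec ![p, 1]) ∧ 0 < c.form j (g⁻¹.1.mulVec ![q, 1]) := by
  rcases hK with hK | hK
  · exact c.exists_axis_conj hM hh hg hij hK
  · obtain ⟨p, q, h, hp, hq⟩ := c.exists_axis_conj hM hh hg hij.symm hK
    exact ⟨q, p, by rw [h, halfCircle_comm], hq, hp⟩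

/-- A cyclically reduced word in which the letters `i` and `j` are adjacent has a conjugate whose
axis joins the sides `i` and `j`. -/
theorem exists_axis_of_adjacent {l : List (Fin 3)} (hl : CyclicallyReduced l)
    (hh : (c.val l).1.IsHyperbolic) {i j : Fin 3} (hij : i ≠ j)
    (hadj : (∃ m, l ~r i :: j :: m) ∨ ∃ m, l ~r j :: i :: m) {g : SL(2, ℝ)} (hg : g ∈ c.group) :
    ∃ p q, halfCircle p q ∈ projAxis c.group (c.val l) ∧
      0 < c.form i (g⁻¹.1.mulVec ![p, 1]) ∧ 0 < c.form j (g⁻¹.1.mulVec ![q, 1]) := by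
  have key : ∀ i j m, l ~r i :: j :: m → ∃ M ∈ c.group, M.1.IsHyperbolic ∧
      axis (g * M * g⁻¹) ∈ projAxis c.group (c.val l) ∧
      ∀ ξ, 0 ≤ c.form j (M.1.mulVec ξ) + c.form i ξ := by
    intro i j m hm
    have hm' : l ~r j :: (m ++ [i]) := by
      refine hm.trans ?_
      exact List.isRotated_append (l := [i]) (l' := j :: m)
    obtain ⟨h, hhm, hval⟩ := c.val_isRotated hm'
    refine ⟨c.val (j :: (m ++ [i])), c.val_mem _, ?_, ?_, fun ξ => ?_⟩
    · rw [hval]; exact isHyperbolic_conj hh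
    · rw [hval]
      have := axis_conj_mem_projAxis (mul_mem hg hhm) (c.val l)
      rwa [mul_inv_rev, show g * h * c.val l * (h⁻¹ * g⁻¹) = g * (h * c.val l * h⁻¹) * g⁻¹ by
        group] at this
    · have := c.form_val_nonneg j (m ++ [i]) (hl.isChain hm') ξ
      simpa using this
  rcases hadj with ⟨m, hm⟩ | ⟨m, hm⟩
  · obtain ⟨M, hM, hhM, hmem, hK⟩ := key i j m hm
    obtain ⟨p, q, h, hpq⟩ := c.exists_axis_conj_of_or hM hhM hg hij (Or.inr hK)
    exact ⟨p, q, by rwa [← h], hpq⟩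
  · obtain ⟨M, hM, hhM, hmem, hK⟩ := key j i m hm
    obtain ⟨p, q, h, hpq⟩ := c.exists_axis_conj_of_or hM hhM hg hij (Or.inl hK)
    exact ⟨p, q, by rwa [← h], hpq⟩

/-- The second factor locates the third vertex `P w = u - 1/(x² gap)` of the image triangle, whose
other vertices are `u` and `∞`. -/
theorem form_one_P_inv (ξ : Fin 2 → ℝ) : c.form 1 (c.P⁻¹.1.mulVec ξ) =
    -(ξ 1 / c.x * (ξ 1 / c.x + c.gap * c.x * (ξ 0 - c.u * ξ 1))) := by
  have hx := c.hx
  obtain ⟨h1, h2, h3, h4⟩ := turn_apply c.u c.x c.hx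
  rw [c.form_signEq (signEq_inv_of_mul_self c.P_mul_self).symm]
  change -((_ - c.u * _) * (_ - c.w * _)) = _
  rw [mulVec_zero, mulVec_one, P, h1, h2, h3, h4, gap]
  field_simp; ring

theorem form_one_R_inv (ξ : Fin 2 → ℝ) : c.form 1 (c.R⁻¹.1.mulVec ξ) =
    ξ 1 / c.z * (-(ξ 1 / c.z) + c.gap * c.z * (ξ 0 - c.w * ξ 1)) := by
  have hz := c.hz
  obtain ⟨h1, h2, h3, h4⟩ := turn_apply c.w c.z c.hz
  rw [c.form_signEq (signEq_inv_of_mul_self c.R_mul_self).symm]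
  change -((_ - c.u * _) * (_ - c.w * _)) = _
  rw [mulVec_zero, mulVec_one, R, h1, h2, h3, h4, gap]
  field_simp; ring

theorem form_gen_inv (i : Fin 3) (ξ : Fin 2 → ℝ) :
    c.form i ((c.gen i)⁻¹.1.mulVec ξ) = -c.form i ξ := by
  rw [c.form_signEq (signEq_inv_of_mul_self (c.gen_mul_self i)).symm, form_gen]

/-- If all pairs of letters are adjacent in a cyclically reduced word, its axis projects to a
geodesic with self-intersections. -/
theorem not_pairwiseDisjoint_of_adjacent {l : List (Fin 3)} (hl : CyclicallyReduced l)
    (hh : (c.val l).1.IsHyperbolic)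
    (hadj : ∀ i j : Fin 3, i ≠ j → (∃ m, l ~r i :: j :: m) ∨ ∃ m, l ~r j :: i :: m) :
    ¬ (projAxis c.group (c.val l)).PairwiseDisjoint id := by
  intro hγ
  have hx := c.hx; have hy := c.hy; have hz := c.hz; have hd := c.gap_pos
  have hw : c.w = c.u + c.gap := by simp [gap]
  -- The corners at `u`, `∞`, `w`, moved to `∞` by `P`, `1`, `R`, give three consecutive triangles
  -- of the fan at the cusp. A lift cuts off the corner at `∞` in each.
  obtain ⟨p₁, q₁, h₁, hp₁, hq₁⟩ :=
    c.exists_axis_of_adjacent hl hh (i := 1) (j := 0) (by decide) (hadj _ _ (by decide)) c.P_mem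
  obtain ⟨p₂, q₂, h₂, hp₂, hq₂⟩ :=
    c.exists_axis_of_adjacent hl hh (i := 0) (j := 2) (by decide) (hadj _ _ (by decide))
      (one_mem _)
  obtain ⟨p₃, q₃, h₃, hp₃, hq₃⟩ :=
    c.exists_axis_of_adjacent hl hh (i := 2) (j := 1) (by decide) (hadj _ _ (by decide)) c.R_mem
  -- The fan spans exactly one period: it runs from `P w` to `R u`, and `P w + a = R u`.
  have hsum : c.u - 1 / (c.x ^ 2 * c.gap) + a = c.w + 1 / (c.z ^ 2 * c.gap) := by
    have h1 : c.gap = (c.x ^ 2 + c.z ^ 2) / (c.x * c.y * c.z) := by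
      rw [gap_eq]; field_simp; ring
    have h2 : 0 < c.x ^ 2 + c.z ^ 2 := by positivity
    rw [hw, h1]
    field_simp
    linear_combination -(c.x ^ 2 + c.z ^ 2) * c.markoff
  have hpos1 : 0 < 1 / (c.x ^ 2 * c.gap) := by positivity
  have hpos2 : 0 < 1 / (c.z ^ 2 * c.gap) := by positivity
  refine false_of_fan hγ (a := a) (r := c.u - 1 / (c.x ^ 2 * c.gap)) (s := c.u) (t := c.w)
    (fun p q h => ?_) (by linarith) (by linarith) (by linarith) h₁ h₂ h₃
    ?_ ?_ ?_ ?_ ?_ ?_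
  · rw [← transl_smul_halfCircle]
    exact smul_mem_projAxis c.transl_mem h
  · rw [form_one_P_inv] at hp₁
    simp at hp₁
    have h1 : c.x⁻¹ + c.gap * c.x * (p₁ - c.u) < 0 := by
      by_contra h
      push Not at h
      have := mul_nonneg (inv_nonneg.2 hx.le) h
      linarith
    have h2 : (p₁ - c.u) * (c.gap * c.x) < -c.x⁻¹ := by linarith
    rw [← lt_div_iff₀ (by positivity)] at h2
    have h3 : -c.x⁻¹ / (c.gap * c.x) = -(1 / (c.x ^ 2 * c.gap)) := by field_simp
    linarith
  · have h1 := c.form_gen_inv 0 ![q₁, 1]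
    rw [show c.gen 0 = c.P from rfl] at h1
    rw [h1] at hq₁
    simp [form] at hq₁
    exact sub_pos.1 (pos_of_mul_pos_right hq₁ hd.le)
  · simp [form] at hp₂
    nlinarith
  · simp [form] at hq₂
    exact sub_pos.1 (pos_of_mul_pos_right hq₂ hd.le)
  · have h1 := c.form_gen_inv 2 ![p₃, 1]
    rw [show c.gen 2 = c.R from rfl] at h1
    rw [h1] at hp₃
    simp [form] at hp₃
    nlinarith
  · rw [form_one_R_inv] at hq₃
    simp at hq₃
    have h1 : 0 < -c.z⁻¹ + c.gap * c.z * (q₃ - c.w) :=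
      pos_of_mul_pos_right hq₃ (inv_nonneg.2 hz.le)
    have h2 : c.z⁻¹ < (q₃ - c.w) * (c.gap * c.z) := by linarith
    rw [← div_lt_iff₀ (by positivity)] at h2
    have h3 : c.z⁻¹ / (c.gap * c.z) = 1 / (c.z ^ 2 * c.gap) := by field_simp
    linarith

/-! ### Simple closed geodesics -/

variable {c} in
/-- For two of the half-turns of a chart, the axis of their product is the axis of the product of
the last two half-turns of another chart. -/
theorem Reach.exists_projAxis_mul {r : Chart a} (hc : Reach r c) {i j : Fin 3} (hij : i ≠ j) :
    ∃ c', Reach r c' ∧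
      projAxis r.group (c.gen i * c.gen j) = projAxis r.group (c'.Q * c'.R) := by
  have hswap : ∀ i j, projAxis r.group (c.gen i * c.gen j) =
      projAxis r.group (c.gen j * c.gen i) := by
    intro i j
    apply projAxis_congr
    rw [← axis_inv (c.gen j * c.gen i), mul_inv_rev]
    exact axis_signEq ((signEq_inv_of_mul_self (c.gen_mul_self i)).mul
      (signEq_inv_of_mul_self (c.gen_mul_self j)))
  have hS : transl a ∈ r.group := r.transl_mem
  have h01 : ∃ c', Reach r c' ∧
      projAxis r.group (c.gen 0 * c.gen 1) = projAxis r.group (c'.Q * c'.R) := by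
    refine ⟨_, hc.shift.shift, ?_⟩
    rw [← projAxis_conj hS (c.gen 0 * c.gen 1), shift_Q, shift_R, shift_R, shift_P]
    congr 1
    change _ = transl a * c.gen 0 * _ * (_ * c.gen 1 * _)
    group
  have h12 : ∃ c', Reach r c' ∧
      projAxis r.group (c.gen 1 * c.gen 2) = projAxis r.group (c'.Q * c'.R) := ⟨c, hc, rfl⟩
  have h02 : ∃ c', Reach r c' ∧
      projAxis r.group (c.gen 0 * c.gen 2) = projAxis r.group (c'.Q * c'.R) :=
    ⟨_, hc.lam, by rw [lam_Q, lam_R]; rfl⟩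
  fin_cases i <;> fin_cases j <;> first | exact absurd rfl hij | skip
  · exact h01
  · exact h02
  · rw [hswap]; exact h01
  · exact h12
  · rw [hswap]; exact h02
  · rw [hswap]; exact h12

theorem two_le_length {l : List (Fin 3)} (hh : (c.val l).1.IsHyperbolic) : 2 ≤ l.length := by
  rw [isHyperbolic_iff] at hh
  match l with
  | [] =>
    obtain ⟨o1, o2, o3, o4⟩ := sl_one_apply
    rw [val_nil, o1, o4] at hh
    norm_num at hh
  | [i] =>
    rw [val_cons, val_nil, mul_one] at hh
    have : c.gen i 0 0 + c.gen i 1 1 = 0 := by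
      fin_cases i
      · exact add_neg_cancel (c.u * c.x)
      · exact add_neg_cancel (c.v * c.y)
      · exact add_neg_cancel (c.w * c.z)
    rw [this] at hh
    norm_num at hh
  | _ :: _ :: _ => simp

theorem isHyperbolic_of_signEq {M N : SL(2, ℝ)} (h : SignEq M N) (hM : M.1.IsHyperbolic) :
    N.1.IsHyperbolic := by
  rw [isHyperbolic_iff] at hM ⊢
  rwa [← sq_trace_signEq h]

variable {c} in
/-- Simple closed geodesics are projections of axes of products of two half-turns of a chart. -/
theorem Reach.exists_projAxis_val {r : Chart a} (hc : Reach r c) (l : List (Fin 3))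
    (hh : (c.val l).1.IsHyperbolic)
    (hγ : (projAxis r.group (c.val l)).PairwiseDisjoint id) :
    ∃ c', Reach r c' ∧ projAxis r.group (c.val l) = projAxis r.group (c'.Q * c'.R) := by
  induction hn : l.length using Nat.strong_induction_on generalizing c l with
  | _ n ih =>
  have hG := hc.group_eq
  have hrot : ∀ l', l ~r l' → projAxis r.group (c.val l') = projAxis r.group (c.val l) ∧
      (c.val l').1.IsHyperbolic := by
    intro l' h
    obtain ⟨g, hg, hval⟩ := c.val_isRotated h
    rw [hG] at hg
    rw [hval]
    exact ⟨projAxis_conj hg _, isHyperbolic_conj hh⟩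
  have hshort : ∀ {c' : Chart a} (l' l'' : List (Fin 3)), Reach r c' → l ~r l' →
      SignEq (c.val l') (c'.val l'') → l''.length < l.length →
      ∃ c', Reach r c' ∧ projAxis r.group (c.val l) = projAxis r.group (c'.Q * c'.R) := by
    intro c' l' l'' hc' hl' hs hlt
    have h1 := projAxis_congr r.group (axis_signEq hs)
    rw [(hrot l' hl').1] at h1
    rw [h1]
    refine ih _ (hn ▸ hlt) hc' l'' (isHyperbolic_of_signEq hs (hrot l' hl').2) ?_ rfl
    rwa [← h1]
  by_cases hred : CyclicallyReduced l
  swap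
  · unfold CyclicallyReduced at hred
    push Not at hred
    obtain ⟨i, m, him⟩ := hred
    refine hshort _ m hc him ?_ ?_
    · rw [val_cons, val_cons, ← mul_assoc, gen_mul_self]
      exact Or.inr (by simp)
    · rw [him.perm.length_eq]; simp
  -- If `i` and `j` are never adjacent, `k` is every other letter: the word is a power of `k x`, or
  -- the chart containing `k i k` shortens it.
  have hcase : ∀ (i j k : Fin 3) (c' : Chart a) (i' j' k' : Fin 3), i ≠ j → i ≠ k → j ≠ k →
      Reach r c' → SignEq (c.gen k * c.gen i * c.gen k) (c'.gen i') →
      SignEq (c.gen j) (c'.gen j') → SignEq (c.gen k) (c'.gen k') →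
      (¬ ((∃ m, l ~r i :: j :: m) ∨ ∃ m, l ~r j :: i :: m)) →
      ∃ c', Reach r c' ∧ projAxis r.group (c.val l) = projAxis r.group (c'.Q * c'.R) := by
    intro i j k c' i' j' k' hij hik hjk hc' hi hj hk hno
    push Not at hno
    have hall : ∀ x : Fin 3, x = i ∨ x = j ∨ x = k := by lia
    rcases hred.cases (c.two_le_length hh) hij hik hjk hall hno.1 hno.2 with
      ⟨x, m, hx, hm⟩ | ⟨ys, hys, hm⟩
    · have hxk : k ≠ x := by rcases hx with rfl | rfl <;> exact Ne.symm ‹_›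
      obtain ⟨c'', hc'', h⟩ := hc.exists_projAxis_mul hxk
      refine ⟨c'', hc'', ?_⟩
      rw [← h, ← (hrot _ hm).1]
      have hhm := (hrot _ hm).2
      rw [val_flatMap_replicate] at hhm ⊢
      exact projAxis_congr _ (axis_pow hhm)
    · obtain ⟨l'', hlt, hs⟩ := exists_shorter hij hi hj hk hys
      exact hshort _ l'' hc' hm hs (by rwa [hm.perm.length_eq])
  by_cases h12 : (∃ m, l ~r 1 :: 2 :: m) ∨ ∃ m, l ~r 2 :: 1 :: m
  swap
  · refine hcase 1 2 0 c.lam 0 2 1 (by decide) (by decide) (by decide) hc.lam ?_ ?_ ?_ h12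
    · change SignEq (c.P * c.Q * c.P) c.lam.P
      rw [lam_P]
      exact (SignEq.refl _).mul (signEq_inv_of_mul_self c.P_mul_self)
    · exact .of_eq c.lam_R.symm
    · exact .of_eq c.lam_Q.symm
  by_cases h02 : (∃ m, l ~r 0 :: 2 :: m) ∨ ∃ m, l ~r 2 :: 0 :: m
  swap
  · refine hcase 0 2 1 c.braidLeft 1 2 0 (by decide) (by decide) (by decide) hc.braidLeft ?_ ?_ ?_
      h02
    · exact c.braidLeft_Q
    · exact .of_eq c.braidLeft_R.symm
    · exact .of_eq c.braidLeft_P.symm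
  by_cases h10 : (∃ m, l ~r 1 :: 0 :: m) ∨ ∃ m, l ~r 0 :: 1 :: m
  swap
  · refine hcase 1 0 2 c.braidRight 2 0 1 (by decide) (by decide) (by decide) hc.braidRight ?_ ?_ ?_
      h10
    · exact c.braidRight_R
    · exact .of_eq c.braidRight_P.symm
    · exact .of_eq c.braidRight_Q.symm
  rw [← hG] at hγ
  refine absurd hγ (c.not_pairwiseDisjoint_of_adjacent hred hh ?_)
  intro i j hij
  fin_cases i <;> fin_cases j <;> first | exact absurd rfl hij | skip
  exacts [h10.symm, h02, h10, h12, h02.symm, h12.symm]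

end Chart

/-! ### The correspondence between the tree and the simple closed geodesics -/

namespace FrickeTriple

variable {τ : FrickeTriple}

theorem projAxis_S_mul_of_translConj {A B : SL(2, ℝ)} (h : TranslConj τ.a A B) :
    projAxis τ.group (τ.S * A) = projAxis τ.group (τ.S * B) := by
  obtain ⟨k, h⟩ := h
  have hk : transl (k * τ.a) ∈ τ.group := by
    rw [← root_group]; exact τ.root.transl_int_mem k
  rw [← projAxis_conj hk (τ.S * A)]
  apply projAxis_congr
  apply axis_signEq
  have h2 : SignEq (transl (k * τ.a) * A * transl (-(k * τ.a))) B := h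
  have h3 : transl (k * τ.a) * (τ.S * A) * (transl (k * τ.a))⁻¹ =
      τ.S * (transl (k * τ.a) * A * transl (-(k * τ.a))) := by
    have : transl (k * τ.a) * τ.S = τ.S * transl (k * τ.a) := by
      rw [S, ← transl_add, ← transl_add, add_comm]
    rw [transl_neg, ← mul_assoc, this]
    group
  rw [h3]
  exact (SignEq.refl _).mul h2

theorem Reach.exists_occurs_projAxis {c : Chart τ.a} (h : Chart.Reach τ.root c) :
    ∃ T, τ.Occurs T ∧ projAxis τ.group (c.Q * c.R) = projAxis τ.group (τ.S * T) := by
  obtain ⟨T, hT, hc⟩ := Reach.exists_occurs h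
  refine ⟨T, hT, ?_⟩
  rw [projAxis_S_mul_of_translConj hc]
  apply projAxis_congr
  rw [← axis_inv (c.Q * c.R)]
  exact (axis_signEq (SignEq.S_mul_signEq (SignEq.refl c.P))).symm

theorem exists_occurs_of_mem_simpleClosedGeodesics {γ : Set (Set ℍ)}
    (hγ : γ ∈ simpleClosedGeodesics τ.group) :
    ∃ T, τ.Occurs T ∧ γ = projAxis τ.group (τ.S * T) := by
  obtain ⟨⟨M, hM, hh, rfl⟩, hd⟩ := hγ
  rw [← root_group] at hM
  obtain ⟨l, hl⟩ := τ.root.exists_val hM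
  have h1 := projAxis_congr τ.group (axis_signEq hl)
  rw [h1] at hd ⊢
  rw [← root_group] at hd ⊢
  obtain ⟨c, hc, h⟩ := Chart.reach_root.exists_projAxis_val l
    (Chart.isHyperbolic_of_signEq hl hh) hd
  rw [h, root_group]
  exact Reach.exists_occurs_projAxis hc

theorem Occurs.elliptic {T : SL(2, ℝ)} (h : τ.Occurs T) : T * T = -1 ∧ 2 / τ.a < invHeight T ∧
    ∃ w : ℍ, w.im = 1 / invHeight T ∧ ∀ v : ℍ, T • v = v ↔ v = w := by
  obtain ⟨c, -, hs⟩ := h.exists_reach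
  have hz := c.hx
  have hh : invHeight T = c.x := invHeight_of_signEq_turn hs
  refine ⟨hs.mul_self.trans c.P_mul_self, ?_, ?_⟩
  · rw [hh, div_lt_iff₀ τ.a_pos, mul_comm]
    exact c.two_lt_mul_x
  rw [hh]
  obtain ⟨h1, h2, h3, h4⟩ := turn_apply c.u c.x c.hx
  obtain ⟨ε, hε, e1, e2, e3, e4⟩ : ∃ ε : ℝ, ε ≠ 0 ∧ T 0 0 = ε * (c.u * c.x) ∧
      T 0 1 = ε * (-(1 + (c.u * c.x) ^ 2) / c.x) ∧ T 1 0 = ε * c.x ∧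
      T 1 1 = ε * (-(c.u * c.x)) := by
    rcases hs.symm with rfl | rfl
    · exact ⟨1, one_ne_zero, by simp only [one_mul]; exact ⟨h1, h2, h3, h4⟩⟩
    · refine ⟨-1, by norm_num, ?_⟩
      simp only [sl_neg_apply, neg_one_mul]
      rw [Chart.P, h1, h2, h3, h4]
      exact ⟨rfl, rfl, rfl, rfl⟩
  refine ⟨⟨⟨c.u, 1 / c.x⟩, by simpa using hz⟩, rfl, fun v => ?_⟩
  have hxc : (c.x : ℂ) ≠ 0 := by exact_mod_cast hz.ne'
  have hεc : (ε : ℂ) ≠ 0 := by exact_mod_cast hε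
  have hden : (c.x * (v : ℂ) - c.u * c.x) ≠ 0 := by
    intro h
    have := congrArg Complex.im h
    simp at this
    exact this.elim hz.ne' v.im_pos.ne'
  have hv : ((v : ℂ) = (⟨c.u, 1 / c.x⟩ : ℂ)) ↔ (v : ℂ) = c.u + Complex.I / c.x := by
    have : (⟨c.u, 1 / c.x⟩ : ℂ) = c.u + Complex.I / c.x := by
      apply Complex.ext <;> simp [Complex.div_re, Complex.div_im, Complex.normSq_apply]
    rw [this]
  rw [UpperHalfPlane.ext_iff, UpperHalfPlane.ext_iff, UpperHalfPlane.coe_specialLinearGroup_apply,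
    e1, e2, e3, e4]
  refine Iff.trans ?_ hv.symm
  simp only [Algebra.algebraMap_self, RingHom.id_apply]
  push_cast
  -- The fixed-point equation factors over the two conjugate roots `u ± i/x`; only one lies in the
  -- upper half-plane.
  have hfac : ((ε * (c.u * c.x) * (v : ℂ) + ε * (-(1 + (c.u * c.x) ^ 2) / c.x)) /
      (ε * c.x * (v : ℂ) + ε * -(c.u * c.x)) = v) ↔
      (c.x * ((v : ℂ) - c.u) - Complex.I) * (c.x * ((v : ℂ) - c.u) + Complex.I) = 0 := by
    rw [show (ε * c.x * (v : ℂ) + ε * -(c.u * c.x)) = ε * (c.x * (v : ℂ) - c.u * c.x) by ring,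
      div_eq_iff (mul_ne_zero hεc hden)]
    have key : (c.x * ((v : ℂ) - c.u) - Complex.I) * (c.x * ((v : ℂ) - c.u) + Complex.I) * ε =
        -c.x * ((ε * (c.u * c.x) * (v : ℂ) + ε * (-(1 + (c.u * c.x) ^ 2) / c.x)) -
          v * (ε * (c.x * (v : ℂ) - c.u * c.x))) := by
      field_simp
      linear_combination -Complex.I_sq
    rw [← sub_eq_zero]
    constructor
    · intro h
      rw [h, mul_zero] at key
      exact (mul_eq_zero.1 key).resolve_right hεc
    · intro h
      rw [h, zero_mul] at key
      exact (mul_eq_zero.1 key.symm).resolve_left (neg_ne_zero.2 hxc)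
  rw [hfac, mul_eq_zero]
  constructor
  · rintro (h | h)
    · field_simp
      linear_combination h
    · have := congrArg Complex.im h
      simp at this
      nlinarith [mul_pos hz v.im_pos]
  · intro h
    left
    rw [h]
    field_simp
    ring

end FrickeTriple

end McShane

end

open McShane in
theorem corollary4 (τ : FrickeTriple) :
    -- the entries of the tree are order-two elliptic elements, and their widths make sense
    (∀ T : SL(2, ℝ), τ.Occurs T → T ∈ τ.group ∧ T * T = -1 ∧ 2 / τ.a < invHeight T ∧
      ∃ w : ℍ, w.im = 1 / invHeight T ∧ ∀ v : ℍ, T • v = v ↔ v = w) ∧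
    -- the sum of the excision widths is at most `a`
    (Summable (fun q : τ.occurringClasses => classWidth τ.a q) ∧
      ∑' q : τ.occurringClasses, classWidth τ.a q ≤ τ.a) ∧
    -- lengths of geodesics and excision widths
    (∀ T : SL(2, ℝ), τ.Occurs T → (τ.S * T).1.IsHyperbolic ∧
      1 / (1 + Real.exp (geodesicLength τ.group (projAxis τ.group (τ.S * T)))) =
        exciseWidth τ.a T / (2 * τ.a)) ∧
    -- every simple closed geodesic arises in this way
    (∀ γ ∈ simpleClosedGeodesics τ.group,
      ∃ T : SL(2, ℝ), τ.Occurs T ∧ γ = projAxis τ.group (τ.S * T)) ∧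
    -- the upper bound in McShane's identity
    (Summable (fun γ : simpleClosedGeodesics τ.group =>
        1 / (1 + Real.exp (geodesicLength τ.group γ))) ∧
      ∑' γ : simpleClosedGeodesics τ.group,
        1 / (1 + Real.exp (geodesicLength τ.group γ)) ≤ 1 / 2) := by
  refine ⟨fun T hT => ⟨hT.mem_group, hT.elliptic⟩,
    τ.summable_classWidth _ Subtype.val_injective fun q => q.2,
    fun T hT => ⟨hT.isHyperbolic, FrickeTriple.one_div_one_add_exp_geodesicLength hT⟩,
    fun γ hγ => FrickeTriple.exists_occurs_of_mem_simpleClosedGeodesics hγ, ?_⟩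
  -- A geodesic can be recovered from the class of its chosen `T`, so distinct geodesics use
  -- distinct terms of the width sum.
  choose T hT hγ using fun γ : simpleClosedGeodesics τ.group =>
    FrickeTriple.exists_occurs_of_mem_simpleClosedGeodesics γ.2
  have hinj : Function.Injective fun γ => Chart.cls τ.a (T γ) := by
    intro γ γ' h
    apply Subtype.ext
    rw [hγ γ, hγ γ']
    exact FrickeTriple.projAxis_S_mul_of_translConj (Quotient.exact h)
  obtain ⟨h1, h2⟩ := τ.summable_classWidth _ hinj fun γ => ⟨T γ, hT γ, rfl⟩
  have heq : (fun γ : simpleClosedGeodesics τ.group =>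
      1 / (1 + Real.exp (geodesicLength τ.group γ))) =
      fun γ => classWidth τ.a (Chart.cls τ.a (T γ)) / (2 * τ.a) := by
    funext γ
    rw [hγ γ, FrickeTriple.one_div_one_add_exp_geodesicLength (hT γ)]
    rfl
  have ha := τ.a_pos
  rw [heq, tsum_div_const]
  refine ⟨h1.div_const _, ?_⟩
  rw [div_le_div_iff₀ (by positivity) (by norm_num)]
  linarith
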